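/- Work in ZFC. For a regular cardinal $\theta$ let $H_\theta$ be the set of all sets whose transitive closure has fewer than $\theta$ elements, and write $x \ll \theta$ if $\mathscr P(\mathscr P(x)) \in H_\theta$. For sets $M, x$ let $\mathrm{Hull}(M,x)=\{f(x) : f\in M \text{ a function}, x\in\mathrm{dom}(f)\}$, and write $x\parallel_{\omega_1} M$ if $\mathrm{Hull}(M,x)\cap\omega_1=M\cap\omega_1$. **Strongly ssp.** Let $\mathbb P$ be a forcing notion, $\theta\gg\mathbb P$ regular and $\mathbb P\in M\prec H_\theta$. A condition $p^*$ is strongly $(M,\mathbb P)$-semigeneric if for every $q\le p^*$ there is $t\in\mathbb P$ such that $t\parallel_{\omega_1}M$ and every $r\in \mathrm{Hull}(M,t)\cap\mathbb P$ with $r\le t$ is compatible with $q$. $\mathbb P$ is strongly semiproper with respect to $M$ if every $p\in\mathbb P\cap M$ has an extension $p^*\le p$ that is strongly $(M,\mathbb P)$-semigeneric. A set $\mathcal X\subseteq[H_\theta]^\omega$ is projective stationary if for every stationary $S\subseteq\omega_1$ the set $\{M\in\mathcal X : M\cap\omega_1\in S\}$ is stationary in $[H_\theta]^\omega$. $\mathbb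 P$ is strongly ssp if for every regular $\theta\gg\mathbb P$ the set of countable $M\prec H_\theta$ with $\mathbb P\in M$ such that $\mathbb P$ is strongly semiproper with respect to $M$ is projective stationary. **The game.** Let $\mathcal K$ be a set of uncountable regular cardinals with $\omega_1\notin\mathcal K$, let $\lambda=\sup\mathcal K$, and let $\mu\gg\lambda$ be a regular cardinal. For $M\prec H_\mu$ with $\mathcal K\in M$ consider the following game for $(M,\mathcal K)$. Put $M_0=M$. In round $n<\omega$, player I plays $(\kappa_n,\nu_n)$ with $\kappa_n\in\mathcal K\cap M_n$ and $\nu_n\in\kappa_n$; player II must answer with an ordinal $\xi_n\in\kappa_n\setminus\nu_n$ such that $M_{n+1}\cap\omega_1=M_n\cap\omega_1$, where $M_{n+1}=\mathrm{Hull}(M_n,\xi_n)$. Player II wins if II does not fail to do so in any round. For a finite run $r$ of $n$ rounds let $M\ltimes r=M_n$. Let $\mathcal W_0$ be the set of all countable $M\prec H_\mu$ with $\mathcal K\in M$ for which player II has a winning strategy in the game for $(M,\mathcal K)$. **The forcing $\mathbb P_0(\mathcal K)$.** A condition is a finite set $p$ such that - every element of $p$ is a triple $(M,r,\Sigma)$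 with $M\in\mathcal W_0$, $\Sigma$ a winning strategy for player II in the game for $(M,\mathcal K)$, and $r$ a finite run of this game in which player II follows $\Sigma$; - any two elements $(M_1,r_1,\Sigma_1)$, $(M_2,r_2,\Sigma_2)$ of $p$ with $M_1\cap\omega_1=M_2\cap\omega_1$ are equal; - for any two elements $(M_1,r_1,\Sigma_1)$, $(M_2,r_2,\Sigma_2)$ of $p$ with $M_1\cap\omega_1<M_2\cap\omega_1$ we have $(M_1,r_1,\Sigma_1)\in M_2\ltimes r_2$. The order is: $q\le p$ iff for every $(M,r,\Sigma)\in p$ there is $(M,r',\Sigma)\in q$ such that the run $r'$ extends the run $r$. **Corollary.** For all such $\mathcal K$ and $\mu$, the forcing $\mathbb P_0(\mathcal K)$ is strongly ssp. -/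

import Mathlib

universe u

open FirstOrder

noncomputable section

namespace Namba

/-! ### The language of set theory and elementary submodels -/

/-- The only relation symbol of the language of set theory is the binary symbol of membership. -/
inductive SetRel : ℕ → Type
  | mem : SetRel 2

/-- The first-order language of set theory. -/
def setLang : Language := ⟨fun _ => Empty, SetRel⟩

/-- The structure `(M, ∈)`. -/
instance memStructure (M : ZFSet.{u}) : setLang.Structure {x : ZFSet.{u} // x ∈ M} where
  funMap := fun f => Empty.elim f
  RelMap := fun r => match r with
    | SetRel.mem => fun x => (x 0).1 ∈ (x 1).1

/-- `M ≺ N`: the inclusion is an elementary embedding of `(M, ∈)` into `(N, ∈)`. -/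
def Elementary (M N : ZFSet.{u}) : Prop :=
  ∃ j : {x : ZFSet.{u} // x ∈ M} ↪ₑ[setLang] {x : ZFSet.{u} // x ∈ N}, ∀ x, (j x).1 = x.1

/-! ### Sets of hereditary size less than `θ` -/

/-- `H_θ` for regular `θ`: the set of all `x` such that `x` and all elements of its transitive
closure have fewer than `θ` elements. For regular `θ` this says that the transitive closure
has fewer than `θ` elements, and every such set belongs to `V_θ` (see `mem_H`). -/
def H (θ : Cardinal.{u}) : ZFSet.{u} :=
  ZFSet.sep (fun x => x.Hereditarily (fun y => y.card < θ)) (ZFSet.vonNeumann θ.ord)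

theorem rank_lt_of_hereditarily {θ : Cardinal.{u}} (hθ : θ.IsRegular) (x : ZFSet.{u}) :
    x.Hereditarily (fun y => y.card < θ) → x.rank < θ.ord := by
  refine ZFSet.inductionOn x ?_
  intro x ih hx
  let f : Shrink.{u} x → Ordinal.{u} := fun i => Order.succ (ZFSet.rank ((equivShrink x).symm i).1)
  have h1 : x.rank ≤ ⨆ i, f i := by
    rw [ZFSet.rank_le_iff]
    intro y hy
    have h2 : f (equivShrink x ⟨y, hy⟩) ≤ ⨆ i, f i := Ordinal.le_iSup f _
    simp only [f, Equiv.symm_apply_apply] at h2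
    exact lt_of_lt_of_le (Order.lt_succ _) h2
  refine lt_of_le_of_lt h1 ?_
  apply Ordinal.iSup_lt_of_lt_cof
  · rw [hθ.cof_ord]; exact hx.self
  · intro i
    have hy := ((equivShrink x).symm i).2
    have hl : Order.IsSuccLimit θ.ord := Cardinal.isSuccLimit_ord hθ.aleph0_le
    exact hl.succ_lt (ih _ hy (hx.mem hy))

theorem mem_H {θ : Cardinal.{u}} (hθ : θ.IsRegular) {x : ZFSet.{u}} :
    x ∈ H θ ↔ x.Hereditarily (fun y => y.card < θ) := by
  rw [H, ZFSet.mem_sep, ZFSet.mem_vonNeumann]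
  exact ⟨fun h => h.2, fun h => ⟨rank_lt_of_hereditarily hθ x h, h⟩⟩

theorem mem_H_of_mem {θ : Cardinal.{u}} (hθ : θ.IsRegular) {x y : ZFSet.{u}}
    (hx : x ∈ H θ) (hy : y ∈ x) : y ∈ H θ :=
  (mem_H hθ).2 (((mem_H hθ).1 hx).mem hy)

/-- `x ≪ θ`: the double power set of `x` belongs to `H_θ`. -/
def MuchLess (x : ZFSet.{u}) (θ : Cardinal.{u}) : Prop :=
  x.powerset.powerset ∈ H θ

/-- The von Neumann ordinal `ω₁`. -/
def om1 : ZFSet.{u} := (Ordinal.omega 1).toZFSet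

/-- `κ` is an uncountable regular cardinal (as a von Neumann ordinal). -/
def IsUncountableRegular (κ : ZFSet.{u}) : Prop :=
  ∃ c : Cardinal.{u}, Cardinal.aleph0 < c ∧ c.IsRegular ∧ κ = c.ord.toZFSet

/-! ### Hulls -/

/-- The set `f` is a function. -/
def IsFunction (f : ZFSet.{u}) : Prop :=
  (∀ z ∈ f, ∃ a b, z = ZFSet.pair a b) ∧
    ∀ a b c, ZFSet.pair a b ∈ f → ZFSet.pair a c ∈ f → b = c

/-- `Hull(M, x) = {f(x) : f ∈ M a function, x ∈ dom f}`; see `mem_Hull`. -/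
def Hull (M x : ZFSet.{u}) : ZFSet.{u} :=
  ZFSet.sep (fun y => ∃ f ∈ M, IsFunction f ∧ ZFSet.pair x y ∈ f)
    (ZFSet.sUnion (ZFSet.sUnion (ZFSet.sUnion M)))

theorem mem_Hull {M x y : ZFSet.{u}} :
    y ∈ Hull M x ↔ ∃ f ∈ M, IsFunction f ∧ ZFSet.pair x y ∈ f := by
  rw [Hull, ZFSet.mem_sep]
  refine ⟨fun h => h.2, fun h => ⟨?_, h⟩⟩
  obtain ⟨f, hf, -, hp⟩ := h
  refine ZFSet.mem_sUnion_of_mem (z := {x, y}) (by simp) ?_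
  refine ZFSet.mem_sUnion_of_mem (z := ZFSet.pair x y) (by simp [ZFSet.pair]) ?_
  exact ZFSet.mem_sUnion_of_mem hp hf

/-- `x ∥_{ω₁} M`: the hull of `M` and `x` has the same countable ordinals as `M`. -/
def ParallelOm1 (x M : ZFSet.{u}) : Prop :=
  Hull M x ∩ om1 = M ∩ om1

/-! ### Clubs, stationary and projective stationary subsets of `[X]^ω` -/

/-- `[X]^ω`, the collection of countably infinite subsets of `X`. -/
def ctblSubsets (X : ZFSet.{u}) : Set ZFSet.{u} :=
  {a | a ⊆ X ∧ (a : Set ZFSet.{u}).Countable ∧ (a : Set ZFSet.{u}).Infinite}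

/-- Closed unbounded subsets of `[X]^ω`. -/
structure IsClubIn (X : ZFSet.{u}) (C : Set ZFSet.{u}) : Prop where
  subset : C ⊆ ctblSubsets X
  unbounded : ∀ a ∈ ctblSubsets X, ∃ c ∈ C, a ⊆ c
  closed : ∀ f : ℕ → ZFSet.{u}, (∀ n, f n ∈ C) → (∀ n, f n ⊆ f (n + 1)) → ZFSet.iUnion f ∈ C

/-- Stationary subsets of `[X]^ω`. -/
def IsStationaryIn (X : ZFSet.{u}) (A : Set ZFSet.{u}) : Prop :=
  A ⊆ ctblSubsets X ∧ ∀ C, IsClubIn X C → (A ∩ C).Nonempty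

/-- Projective stationary subsets of `[X]^ω`. -/
def IsProjectiveStationary (X : ZFSet.{u}) (A : Set ZFSet.{u}) : Prop :=
  A ⊆ ctblSubsets X ∧
    ∀ S : Set (Set.Iio (Ordinal.omega.{u} 1)), IsStationary S →
      IsStationaryIn X {M | M ∈ A ∧ ∃ δ ∈ S, M ∩ om1 = δ.1.toZFSet}

/-! ### Forcing notions and strong semiproperness -/

/-- A forcing notion: a set of conditions with a set-coded preorder;
`ZFSet.pair q p ∈ le` means `q ≤ p`. -/
structure Forcing where
  carrier : ZFSet.{u}
  le : ZFSet.{u}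
  le_sub : le ⊆ ZFSet.prod carrier carrier
  refl : ∀ p ∈ carrier, ZFSet.pair p p ∈ le
  trans : ∀ p q r, ZFSet.pair p q ∈ le → ZFSet.pair q r ∈ le → ZFSet.pair p r ∈ le

namespace Forcing

variable (P : Forcing.{u})

/-- `q ≤ p`. -/
def LE (q p : ZFSet.{u}) : Prop := ZFSet.pair q p ∈ P.le

/-- `p ∥ q`: the conditions `p` and `q` have a common lower bound. -/
def Compatible (p q : ZFSet.{u}) : Prop := ∃ s ∈ P.carrier, P.LE s p ∧ P.LE s q

/-- The forcing notion as an element of the universe of sets. -/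
def toSet : ZFSet.{u} := ZFSet.pair P.carrier P.le

/-- The condition `p` is strongly `(M, P)`-semigeneric. The witness `t` is the trace of `q`. -/
def StronglySemigeneric (M p : ZFSet.{u}) : Prop :=
  ∀ q ∈ P.carrier, P.LE q p → ∃ t ∈ P.carrier, ParallelOm1 t M ∧
    ∀ r ∈ Hull M t, r ∈ P.carrier → P.LE r t → P.Compatible r q

/-- `P` is strongly semiproper with respect to `M`. -/
def StronglySemiproper (M : ZFSet.{u}) : Prop :=
  ∀ p ∈ P.carrier, p ∈ M → ∃ s ∈ P.carrier, P.LE s p ∧ P.StronglySemigeneric M s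

/-- `P` is strongly ssp: for every regular `θ ≫ P` there are projective stationary many
countable `M ≺ H_θ` with `P ∈ M` such that `P` is strongly semiproper with respect to `M`. -/
def StronglySSP : Prop :=
  ∀ θ : Cardinal.{u}, θ.IsRegular → MuchLess P.carrier θ →
    IsProjectiveStationary (H θ)
      {M | M ∈ ctblSubsets (H θ) ∧ Elementary M (H θ) ∧ P.toSet ∈ M ∧ P.StronglySemiproper M}

end Forcing

/-! ### The multiple Namba game -/

/-- One round of the game: the first player plays `(κ, ν)`, the second player answers `ξ`. -/
structure Round where
  κ : ZFSet.{u}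
  ν : ZFSet.{u}
  ξ : ZFSet.{u}

/-- A round `((κ, ν), ξ)` as a set. -/
def Round.code (m : Round.{u}) : ZFSet.{u} := ZFSet.pair (ZFSet.pair m.κ m.ν) m.ξ

/-- A finite sequence of rounds as a set: the function on `n` with `i ↦ ((κ_i, ν_i), ξ_i)`. -/
def codeRun (r : List Round.{u}) : ZFSet.{u} :=
  ZFSet.range (fun i : Fin r.length =>
    ZFSet.pair (Ordinal.toZFSet ((i.1 : ℕ) : Ordinal.{u})) (r.get i).code)

/-- `M ⋉ r`: the last of the models `M_0 = M`, `M_{n+1} = Hull(M_n, ξ_n)`. -/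
def model (M : ZFSet.{u}) (r : List Round.{u}) : ZFSet.{u} :=
  r.foldl (fun N m => Hull N m.ξ) M

/-- The first player may play `(κ, ν)` when the current model is `N`. -/
def LegalPI (K N κ ν : ZFSet.{u}) : Prop := κ ∈ K ∧ κ ∈ N ∧ ν ∈ κ

/-- The second player does not lose by answering `ξ` to `(κ, ν)` when the current model is `N`. -/
def LegalPII (N κ ν ξ : ZFSet.{u}) : Prop :=
  ξ ∈ κ ∧ ξ ∉ ν ∧ Hull N ξ ∩ om1 = N ∩ om1

/-- `r` is a finite run of the game for `(M, K)` in which the second player has not lost. -/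
def IsRun (K : ZFSet.{u}) : ZFSet.{u} → List Round.{u} → Prop
  | _, [] => True
  | M, m :: r => LegalPI K M m.κ m.ν ∧ LegalPII M m.κ m.ν m.ξ ∧ IsRun K (Hull M m.ξ) r

/-- The position after the run `r` and the move `(κ, ν)` of the first player, as a set. -/
def position (r : List Round.{u}) (κ ν : ZFSet.{u}) : ZFSet.{u} :=
  ZFSet.pair (codeRun r) (ZFSet.pair κ ν)

/-- `s` is a strategy for the second player: a function that assigns to each position of the
game at which this player is to move an ordinal `ξ ∈ κ`. -/
def IsStrategy (K M s : ZFSet.{u}) : Prop :=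
  IsFunction s ∧
  (∀ x, (∃ y, ZFSet.pair x y ∈ s) ↔
    ∃ r κ ν, IsRun K M r ∧ LegalPI K (model M r) κ ν ∧ x = position r κ ν) ∧
  ∀ r κ ν ξ, ZFSet.pair (position r κ ν) ξ ∈ s → ξ ∈ κ

/-- In the run `r` the second player follows the strategy `s`. -/
def Follows (s : ZFSet.{u}) (r : List Round.{u}) : Prop :=
  ∀ r₁ m r₂, r = r₁ ++ m :: r₂ → ZFSet.pair (position r₁ m.κ m.ν) m.ξ ∈ s

/-- `s` is a winning strategy for the second player: following `s`, this player does not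
lose in any round. -/
def IsWinningStrategy (K M s : ZFSet.{u}) : Prop :=
  IsStrategy K M s ∧
  ∀ r κ ν ξ, IsRun K M r → Follows s r → LegalPI K (model M r) κ ν →
    ZFSet.pair (position r κ ν) ξ ∈ s → LegalPII (model M r) κ ν ξ

/-! ### The forcing -/

/-- The countable `M ≺ H_μ` with `K ∈ M` for which the second player has a winning strategy. -/
def W0 (K : ZFSet.{u}) (μ : Cardinal.{u}) : Set ZFSet.{u} :=
  {M | (M : Set ZFSet.{u}).Countable ∧ Elementary M (H μ) ∧ K ∈ M ∧ ∃ s, IsWinningStrategy K M s}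

/-- The tuple `(M, r, s)` as a set. -/
def triple (M : ZFSet.{u}) (r : List Round.{u}) (s : ZFSet.{u}) : ZFSet.{u} :=
  ZFSet.pair M (ZFSet.pair (codeRun r) s)

/-- `p` is a condition of the forcing. -/
structure IsCond (K : ZFSet.{u}) (μ : Cardinal.{u}) (p : ZFSet.{u}) : Prop where
  finite : (p : Set ZFSet.{u}).Finite
  elem : ∀ t ∈ p, ∃ M r s, t = triple M r s ∧ M ∈ W0 K μ ∧ IsWinningStrategy K M s ∧
    IsRun K M r ∧ Follows s r
  eq : ∀ M₁ r₁ s₁ M₂ r₂ s₂, triple M₁ r₁ s₁ ∈ p → triple M₂ r₂ s₂ ∈ p →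
    M₁ ∩ om1 = M₂ ∩ om1 → triple M₁ r₁ s₁ = triple M₂ r₂ s₂
  mem : ∀ M₁ r₁ s₁ M₂ r₂ s₂, triple M₁ r₁ s₁ ∈ p → triple M₂ r₂ s₂ ∈ p →
    M₁ ∩ om1 ∈ M₂ ∩ om1 → triple M₁ r₁ s₁ ∈ model M₂ r₂

/-- The order of the forcing: `q ≤ p`. -/
def CondLE (q p : ZFSet.{u}) : Prop :=
  ∀ M r s, triple M r s ∈ p → ∃ r', triple M r' s ∈ q ∧ r <+: r'

/-- The set of all conditions. The bounding set is large enough to contain every condition,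
see `mem_conditions`. -/
def conditions (K : ZFSet.{u}) (μ : Cardinal.{u}) : ZFSet.{u} :=
  ZFSet.sep (IsCond K μ) (ZFSet.powerset
    (ZFSet.prod (ZFSet.powerset (ZFSet.vonNeumann μ.ord))
      (ZFSet.prod (ZFSet.powerset (ZFSet.vonNeumann μ.ord))
        (ZFSet.powerset (ZFSet.vonNeumann μ.ord)))))

/-- The forcing `P_0(K)`, built from the models in `W0 K μ`. -/
def P0 (K : ZFSet.{u}) (μ : Cardinal.{u}) : Forcing.{u} where
  carrier := conditions K μ
  le := ZFSet.pairSep CondLE (conditions K μ) (conditions K μ)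
  le_sub := by
    intro z hz
    obtain ⟨a, ha, b, hb, h, -⟩ := ZFSet.mem_pairSep.1 hz
    exact ZFSet.mem_prod.2 ⟨a, ha, b, hb, h⟩
  refl := by
    intro p hp
    exact ZFSet.mem_pairSep.2 ⟨p, hp, p, hp, rfl, fun M r s h => ⟨r, h, List.prefix_rfl⟩⟩
  trans := by
    intro p q r hpq hqr
    obtain ⟨a, ha, b, hb, h, hab⟩ := ZFSet.mem_pairSep.1 hpq
    obtain ⟨b', hb', c, hc, h', hbc⟩ := ZFSet.mem_pairSep.1 hqr
    obtain ⟨rfl, rfl⟩ := ZFSet.pair_inj.1 h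
    obtain ⟨rfl, rfl⟩ := ZFSet.pair_inj.1 h'
    refine ZFSet.mem_pairSep.2 ⟨p, ha, r, hc, rfl, fun M l s hl => ?_⟩
    obtain ⟨l', hl', h1⟩ := hbc M l s hl
    obtain ⟨l'', hl'', h2⟩ := hab M l' s hl'
    exact ⟨l'', hl'', h1.trans h2⟩

/-! ### Every condition belongs to the set of conditions -/

theorem Round.code_injective : Function.Injective Round.code.{u} := by
  rintro ⟨a, b, c⟩ ⟨a', b', c'⟩ h
  simp only [Round.code, ZFSet.pair_inj] at h
  obtain ⟨⟨rfl, rfl⟩, rfl⟩ := h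
  rfl

theorem pair_mem_codeRun {r : List Round.{u}} {i : ℕ} {x : ZFSet.{u}} :
    ZFSet.pair (Ordinal.toZFSet (i : Ordinal.{u})) x ∈ codeRun r ↔
      ∃ h : i < r.length, (r.get ⟨i, h⟩).code = x := by
  rw [codeRun, ZFSet.mem_range]
  constructor
  · rintro ⟨j, hj⟩
    obtain ⟨h1, h2⟩ := ZFSet.pair_inj.1 hj
    have h3 : j.1 = i := by exact_mod_cast Ordinal.toZFSet_injective h1
    subst h3
    exact ⟨j.2, h2⟩
  · rintro ⟨h, rfl⟩
    exact ⟨⟨i, h⟩, rfl⟩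

theorem codeRun_injective : Function.Injective codeRun.{u} := by
  intro r r' h
  have key : ∀ i (x : ZFSet.{u}), (∃ h : i < r.length, (r.get ⟨i, h⟩).code = x) ↔
      ∃ h : i < r'.length, (r'.get ⟨i, h⟩).code = x := by
    intro i x
    rw [← pair_mem_codeRun, ← pair_mem_codeRun, h]
  have hlen : ∀ i, i < r.length ↔ i < r'.length := fun i =>
    ⟨fun hi => ((key i _).1 ⟨hi, rfl⟩).1, fun hi => ((key i _).2 ⟨hi, rfl⟩).1⟩
  have hl : r.length = r'.length := by
    have h1 := hlen r.length
    have h2 := hlen r'.length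
    omega
  refine List.ext_get hl fun i h1 h2 => ?_
  obtain ⟨_, h3⟩ := (key i _).1 ⟨h1, rfl⟩
  exact (Round.code_injective h3).symm

theorem triple_inj {M M' s s' : ZFSet.{u}} {r r' : List Round.{u}} :
    triple M r s = triple M' r' s' ↔ M = M' ∧ r = r' ∧ s = s' := by
  simp only [triple, ZFSet.pair_inj, codeRun_injective.eq_iff]

theorem pair_mem_vonNeumann {o : Ordinal.{u}} (ho : Order.IsSuccLimit o) {x y : ZFSet.{u}}
    (hx : x ∈ ZFSet.vonNeumann o) (hy : y ∈ ZFSet.vonNeumann o) :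
    ZFSet.pair x y ∈ ZFSet.vonNeumann o := by
  rw [ZFSet.mem_vonNeumann] at *
  simp only [ZFSet.pair, ZFSet.rank_pair, ZFSet.rank_singleton]
  exact max_lt (ho.succ_lt (ho.succ_lt hx))
    (ho.succ_lt (max_lt (ho.succ_lt hx) (ho.succ_lt hy)))

theorem IsRun.mem_K {K : ZFSet.{u}} : ∀ {r : List Round.{u}} {M : ZFSet.{u}}, IsRun K M r →
    ∀ m ∈ r, m.κ ∈ K ∧ m.ν ∈ m.κ ∧ m.ξ ∈ m.κ
  | [], _, _, m, hm => by simp at hm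
  | a :: r, M, h, m, hm => by
    rcases List.mem_cons.1 hm with rfl | hm
    · exact ⟨h.1.1, h.1.2.2, h.2.1.1⟩
    · exact IsRun.mem_K h.2.2 m hm

section Bound

variable {K : ZFSet.{u}} {μ : Cardinal.{u}}

theorem mem_vonNeumann_of_mem_K (hμ : μ.IsRegular) (hK : MuchLess (ZFSet.sUnion K) μ)
    {κ : ZFSet.{u}} (hκ : κ ∈ K) : κ ∈ ZFSet.vonNeumann μ.ord := by
  have h1 : ZFSet.sUnion K ∈ H μ :=
    mem_H_of_mem hμ (mem_H_of_mem hμ hK (ZFSet.mem_powerset.2 (fun _ h => h)))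
      (ZFSet.mem_powerset.2 (fun _ h => h))
  exact ZFSet.mem_vonNeumann_of_subset (fun y hy => ZFSet.mem_sUnion_of_mem hy hκ)
    (ZFSet.mem_sep.1 h1).1

theorem codeRun_subset (hμ : μ.IsRegular) (hK : MuchLess (ZFSet.sUnion K) μ)
    {M : ZFSet.{u}} {r : List Round.{u}} (hr : IsRun K M r) :
    codeRun r ⊆ ZFSet.vonNeumann μ.ord := by
  have ho : Order.IsSuccLimit μ.ord := Cardinal.isSuccLimit_ord hμ.aleph0_le
  have ht : ∀ {a b : ZFSet.{u}}, a ∈ b → b ∈ ZFSet.vonNeumann μ.ord →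
      a ∈ ZFSet.vonNeumann μ.ord := fun h1 h2 => ZFSet.isTransitive_vonNeumann _ _ h2 h1
  intro z hz
  obtain ⟨i, rfl⟩ := ZFSet.mem_range.1 hz
  obtain ⟨h1, h2, h3⟩ := hr.mem_K _ (List.get_mem r i)
  have h4 := mem_vonNeumann_of_mem_K hμ hK h1
  refine pair_mem_vonNeumann ho ?_
    (pair_mem_vonNeumann ho (pair_mem_vonNeumann ho h4 (ht h2 h4)) (ht h3 h4))
  rw [ZFSet.mem_vonNeumann, Ordinal.rank_toZFSet, Cardinal.lt_ord, Ordinal.card_nat]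
  exact hμ.nat_lt _

theorem codeRun_mem (hμ : μ.IsRegular) (hK : MuchLess (ZFSet.sUnion K) μ)
    {M : ZFSet.{u}} {r : List Round.{u}} (hr : IsRun K M r) :
    codeRun r ∈ ZFSet.vonNeumann μ.ord := by
  have ho : Order.IsSuccLimit μ.ord := Cardinal.isSuccLimit_ord hμ.aleph0_le
  rw [ZFSet.mem_vonNeumann]
  let f : Fin r.length → Ordinal.{u} := fun i => ZFSet.rank
    (ZFSet.pair (Ordinal.toZFSet ((i.1 : ℕ) : Ordinal.{u})) (r.get i).code)
  have hf : ∀ i, f i < μ.ord := fun i => ZFSet.mem_vonNeumann.1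
    (codeRun_subset hμ hK hr (ZFSet.mem_range.2 ⟨i, rfl⟩))
  have hsup : Order.succ (Finset.univ.sup f) < μ.ord := by
    refine ho.succ_lt ((Finset.sup_lt_iff ?_).2 fun i _ => hf i)
    exact lt_of_le_of_lt bot_le (Cardinal.lt_ord.2 (by simpa using hμ.pos) : (0 : Ordinal) < _)
  refine lt_of_le_of_lt (ZFSet.rank_le_iff.2 fun z hz => ?_) hsup
  obtain ⟨i, rfl⟩ := ZFSet.mem_range.1 hz
  exact Order.lt_succ_of_le (Finset.le_sup (f := f) (Finset.mem_univ i))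

theorem IsStrategy.subset (hμ : μ.IsRegular) (hK : MuchLess (ZFSet.sUnion K) μ)
    {M s : ZFSet.{u}} (hs : IsStrategy K M s) : s ⊆ ZFSet.vonNeumann μ.ord := by
  have ho : Order.IsSuccLimit μ.ord := Cardinal.isSuccLimit_ord hμ.aleph0_le
  have ht : ∀ {a b : ZFSet.{u}}, a ∈ b → b ∈ ZFSet.vonNeumann μ.ord →
      a ∈ ZFSet.vonNeumann μ.ord := fun h1 h2 => ZFSet.isTransitive_vonNeumann _ _ h2 h1
  intro z hz
  obtain ⟨x, y, rfl⟩ := hs.1.1 z hz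
  obtain ⟨r, κ, ν, hr, hl, rfl⟩ := (hs.2.1 x).1 ⟨y, hz⟩
  have hκ := mem_vonNeumann_of_mem_K hμ hK hl.1
  exact pair_mem_vonNeumann ho (pair_mem_vonNeumann ho (codeRun_mem hμ hK hr)
    (pair_mem_vonNeumann ho hκ (ht hl.2.2 hκ))) (ht (hs.2.2 r κ ν y hz) hκ)

theorem Elementary.subset {M N : ZFSet.{u}} (h : Elementary M N) : M ⊆ N := by
  intro x hx
  obtain ⟨j, hj⟩ := h
  have h1 := (j ⟨x, hx⟩).2
  rwa [hj] at h1

theorem mem_conditions (hμ : μ.IsRegular) (hK : MuchLess (ZFSet.sUnion K) μ) {p : ZFSet.{u}} :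
    p ∈ conditions K μ ↔ IsCond K μ p := by
  rw [conditions, ZFSet.mem_sep]
  refine ⟨fun h => h.2, fun h => ⟨?_, h⟩⟩
  rw [ZFSet.mem_powerset]
  intro t ht
  obtain ⟨M, r, s, rfl, hM, hs, hr, -⟩ := h.elem t ht
  refine ZFSet.pair_mem_prod.2 ⟨?_, ZFSet.pair_mem_prod.2 ⟨?_, ?_⟩⟩
  · exact ZFSet.mem_powerset.2 fun x hx => (ZFSet.mem_sep.1 (hM.2.1.subset hx)).1
  · exact ZFSet.mem_powerset.2 (codeRun_subset hμ hK hr)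
  · exact ZFSet.mem_powerset.2 (hs.1.subset hμ hK)

end Bound

end Namba

end

noncomputable section

namespace Namba

/-! The proof has two halves: there are projective stationary many models for which the second
player wins, and `P0 K μ` is strongly semiproper with respect to any `M ≺ H θ` with `M ∩ H μ` among
them.

Existence (`exists_winning_model`). The game is closed for the second player, hence determined
(`exists_isWinningStrategy`). Suppose that the first player wins for all relevant models with trace
in a stationary set `S`. For `δ ∈ S` let `N δ` be the part in `H μ` of the closure of `δ` under
suitable operations, and, when this closure has trace `δ`, let `T δ` be a well-founded tree by which
the first player wins for `N δ`. Play against all `ω₁` trees at once: once the cardinals `κ₀, …, κₙ`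
have been chosen, answer by the supremum of all ordinals below `κₙ` that the remaining trees play
together with `κₙ`. It lies below `κₙ`, as `κₙ` is regular and greater than `ω₁`, and it depends on
the cardinals only, not on `δ`. Hence the closure of `δ` under these answers has trace `δ` for club
many `δ`. For such a `δ ∈ S` no answer adds a countable ordinal, so all answers are legal, and the
well-founded tree `T δ` is refuted.

Semiproperness (`stronglySemiproper_P0`). Given `p ∈ M`, add `(M ∩ H μ, [], s₀)` to `p`, where `s₀`
is a winning strategy. A stronger `q` contains some `(M ∩ H μ, r, s₀)`. Let `N` be the last model of
`r`; the trace of `q` is `t = q ∩ N`. Playing `r` on `M` itself gives `M' ≺ H θ` with `M' ∩ H μ = N`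
(`IsRun.model_inter`), so `Hull M t ⊆ M'` adds no countable ordinals. A condition `w ≤ t` in this
hull is a finite subset of `N`, and the elements of `q` outside `N` have last models including `N`;
so `w ∪ (q \ N)` is a common extension of `w` and `q`.

Two points remain: `H μ ∈ H θ` has to be derived from `θ ≫ P0 K μ` (`H_mem_H`), and the degenerate
case `μ = ℵ₀` is treated separately. -/

/-! ### Definable relations -/

/-- The relation `R` is definable without parameters in `(X, ∈)`. -/
def Dfn (X : ZFSet.{u}) {α : Type} (R : (α → ZFSet.{u}) → Prop) : Prop :=
  ∃ φ : setLang.Formula α, ∀ v : α → {x : ZFSet.{u} // x ∈ X},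
    φ.Realize v ↔ R (fun a => (v a).1)

/-- Adds the value of a new variable `0` to an assignment. -/
def push (x : ZFSet.{u}) (v : ℕ → ZFSet.{u}) : ℕ → ZFSet.{u}
  | 0 => x
  | n + 1 => v n

namespace Dfn

variable {X : ZFSet.{u}} {α β : Type}

/-- Agreement on values in `X` suffices, so this is where absoluteness arguments enter. -/
theorem congr {R S : (α → ZFSet.{u}) → Prop} (hR : Dfn X R)
    (h : ∀ v, (∀ a, v a ∈ X) → (S v ↔ R v)) : Dfn X S := by
  obtain ⟨φ, hφ⟩ := hR
  exact ⟨φ, fun v => (hφ v).trans (h _ fun a => (v a).2).symm⟩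

theorem mem (a b : α) : Dfn X (fun v => v a ∈ v b) := by
  let r : setLang.Relations 2 := SetRel.mem
  refine ⟨r.formula ![Language.Term.var a, Language.Term.var b], fun v => ?_⟩
  rw [Language.Formula.realize_rel]
  rfl

theorem eq (a b : α) : Dfn X (fun v => v a = v b) := by
  refine ⟨Language.Term.equal (Language.Term.var a) (Language.Term.var b), fun v => ?_⟩
  rw [Language.Formula.realize_equal, Language.Term.realize_var, Language.Term.realize_var,
    Subtype.ext_iff]

theorem not {R : (α → ZFSet.{u}) → Prop} (hR : Dfn X R) : Dfn X (fun v => ¬ R v) := by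
  obtain ⟨φ, hφ⟩ := hR
  exact ⟨φ.not, fun v => by rw [Language.Formula.realize_not, hφ]⟩

theorem and {R S : (α → ZFSet.{u}) → Prop} (hR : Dfn X R) (hS : Dfn X S) :
    Dfn X (fun v => R v ∧ S v) := by
  obtain ⟨φ, hφ⟩ := hR
  obtain ⟨ψ, hψ⟩ := hS
  exact ⟨φ ⊓ ψ, fun v => by rw [Language.Formula.realize_inf, hφ, hψ]⟩

theorem or {R S : (α → ZFSet.{u}) → Prop} (hR : Dfn X R) (hS : Dfn X S) :
    Dfn X (fun v => R v ∨ S v) :=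
  (hR.not.and hS.not).not.congr fun _ _ => by tauto

theorem imp {R S : (α → ZFSet.{u}) → Prop} (hR : Dfn X R) (hS : Dfn X S) :
    Dfn X (fun v => R v → S v) :=
  (hR.and hS.not).not.congr fun _ _ => by tauto

theorem iff {R S : (α → ZFSet.{u}) → Prop} (hR : Dfn X R) (hS : Dfn X S) :
    Dfn X (fun v => R v ↔ S v) :=
  ((hR.imp hS).and (hS.imp hR)).congr fun _ _ => iff_iff_implies_and_implies

theorem relabel {R : (α → ZFSet.{u}) → Prop} (hR : Dfn X R) (f : α → β) :
    Dfn X (fun v => R (fun a => v (f a))) := by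
  obtain ⟨φ, hφ⟩ := hR
  exact ⟨φ.relabel f, fun v => by rw [Language.Formula.realize_relabel, hφ]; rfl⟩

theorem forall_finite {ι : Type} [Finite ι] {R : ι → (α → ZFSet.{u}) → Prop}
    (hR : ∀ i, Dfn X (R i)) : Dfn X (fun v => ∀ i, R i v) := by
  choose φ hφ using hR
  exact ⟨Language.Formula.iInf φ, fun v => by simp [Language.Formula.realize_iInf, hφ]⟩

theorem exists_finite [Finite β] {R : (α ⊕ β → ZFSet.{u}) → Prop} (hR : Dfn X R) :
    Dfn X (fun v => ∃ w : β → ZFSet.{u}, (∀ b, w b ∈ X) ∧ R (Sum.elim v w)) := by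
  obtain ⟨φ, hφ⟩ := hR
  refine ⟨φ.iExs β, fun v => ?_⟩
  rw [Language.Formula.realize_iExs]
  have key : ∀ i : β → {x : ZFSet.{u} // x ∈ X},
      (fun a => (Sum.elim v i a).1) = Sum.elim (fun a => (v a).1) (fun b => (i b).1) := by
    intro i
    funext a
    cases a <;> rfl
  constructor
  · rintro ⟨i, hi⟩
    exact ⟨fun b => (i b).1, fun b => (i b).2, by rwa [hφ, key] at hi⟩
  · rintro ⟨w, hw, h⟩
    exact ⟨fun b => ⟨w b, hw b⟩, by rwa [hφ, key]⟩

/-- Variables are de Bruijn indices: under a quantifier the bound variable has index `0` and all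
outer indices go up by one. This governs the indices in all later definability proofs. -/
theorem exists_mem {R : ZFSet.{u} → (ℕ → ZFSet.{u}) → Prop}
    (hR : Dfn X (fun v => R (v 0) (fun n => v (n + 1)))) : Dfn X (fun v => ∃ x ∈ X, R x v) := by
  refine ((hR.relabel (β := ℕ ⊕ Unit)
    (fun n => Nat.casesOn n (Sum.inr ()) Sum.inl)).exists_finite).congr fun v _ => ?_
  constructor
  · rintro ⟨x, hx, h⟩
    exact ⟨fun _ => x, fun _ => hx, h⟩
  · rintro ⟨w, hw, h⟩
    exact ⟨w (), hw (), h⟩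

theorem forall_mem {R : ZFSet.{u} → (ℕ → ZFSet.{u}) → Prop}
    (hR : Dfn X (fun v => R (v 0) (fun n => v (n + 1)))) : Dfn X (fun v => ∀ x ∈ X, R x v) :=
  (exists_mem (R := fun x v => ¬ R x v) hR.not).not.congr fun _ _ => by push Not; rfl

/-- Since `X` is transitive, the elements of `v i` are in the range of the quantifiers of `(X, ∈)`.
-/
theorem bex (hX : X.IsTransitive) {R : ZFSet.{u} → (ℕ → ZFSet.{u}) → Prop} {i : ℕ}
    (hR : Dfn X (fun v => R (v 0) (fun n => v (n + 1)))) : Dfn X (fun v => ∃ x ∈ v i, R x v) := by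
  refine (exists_mem (R := fun x v => x ∈ v i ∧ R x v) ((mem 0 (i + 1)).and hR)).congr
    fun v hv => ?_
  exact ⟨fun ⟨x, h1, h2⟩ => ⟨x, hX _ (hv i) h1, h1, h2⟩, fun ⟨x, _, h1, h2⟩ => ⟨x, h1, h2⟩⟩

theorem ball (hX : X.IsTransitive) {R : ZFSet.{u} → (ℕ → ZFSet.{u}) → Prop} {i : ℕ}
    (hR : Dfn X (fun v => R (v 0) (fun n => v (n + 1)))) : Dfn X (fun v => ∀ x ∈ v i, R x v) :=
  (bex hX (R := fun x v => ¬ R x v) hR.not).not.congr fun _ _ => by push Not; rfl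

theorem isEmpty (hX : X.IsTransitive) (i : ℕ) : Dfn X (fun v => v i = ∅) :=
  (ball hX (R := fun _ _ => False) ((mem 0 0).congr fun _ _ =>
    ⟨False.elim, fun h => ZFSet.mem_irrefl _ h⟩)).congr fun _ _ => ZFSet.eq_empty _

theorem eq_insert (hX : X.IsTransitive) (i j k : ℕ) :
    Dfn X (fun v => v i = insert (v j) (v k)) := by
  refine ((mem j i).and ((ball hX (R := fun x v => x ∈ v i) (i := k) (mem 0 (i + 1))).and
    (ball hX (R := fun x v => x = v j ∨ x ∈ v k) (i := i)
      ((eq 0 (j + 1)).or (mem 0 (k + 1)))))).congr fun v _ => ?_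
  constructor
  · intro h
    rw [h]
    simp +contextual
  · rintro ⟨h1, h2, h3⟩
    ext x
    rw [ZFSet.mem_insert_iff]
    refine ⟨h3 x, ?_⟩
    rintro (rfl | h)
    exacts [h1, h2 x h]

theorem eq_singleton (hX : X.IsTransitive) (i j : ℕ) :
    Dfn X (fun v => v i = {v j}) := by
  refine ((mem j i).and (ball hX (R := fun x v => x = v j) (i := i) (eq 0 (j + 1)))).congr
    fun v _ => ?_
  constructor
  · intro h
    rw [h]
    simp
  · rintro ⟨h1, h3⟩
    ext x
    rw [ZFSet.mem_singleton]
    exact ⟨h3 x, fun h => h ▸ h1⟩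

theorem eq_unordered (hX : X.IsTransitive) (i j k : ℕ) :
    Dfn X (fun v => v i = {v j, v k}) := by
  refine ((mem j i).and ((mem k i).and
    (ball hX (R := fun x v => x = v j ∨ x = v k) (i := i)
      ((eq 0 (j + 1)).or (eq 0 (k + 1)))))).congr fun v _ => ?_
  constructor
  · intro h
    rw [h]
    simp
  · rintro ⟨h1, h2, h3⟩
    ext x
    rw [ZFSet.mem_pair]
    refine ⟨h3 x, ?_⟩
    rintro (rfl | rfl)
    exacts [h1, h2]

theorem eq_pair (hX : X.IsTransitive) (i j k : ℕ) :
    Dfn X (fun v => v i = ZFSet.pair (v j) (v k)) := by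
  refine (bex hX (i := i) (R := fun y v => y = {v j} ∧ ∃ z ∈ v i, z = {v j, v k} ∧
    v i = {y, z}) ((eq_singleton hX 0 (j + 1)).and (bex hX (i := i + 1)
      (R := fun z v => z = {v (j + 1), v (k + 1)} ∧ v (i + 1) = {v 0, z})
      ((eq_unordered hX 0 (j + 2) (k + 2)).and (eq_unordered hX (i + 2) 1 0))))).congr
    fun v _ => ?_
  constructor
  · intro h
    rw [h]
    exact ⟨{v j}, by simp [ZFSet.pair], rfl, {v j, v k}, by simp [ZFSet.pair], rfl, rfl⟩
  · rintro ⟨y, -, rfl, z, -, rfl, h⟩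
    exact h

theorem pair_mem (hX : X.IsTransitive) (i j k : ℕ) :
    Dfn X (fun v => ZFSet.pair (v j) (v k) ∈ v i) :=
  (bex hX (i := i) (R := fun z v => z = ZFSet.pair (v j) (v k))
    (eq_pair hX 0 (j + 1) (k + 1))).congr fun _ _ => by simp

end Dfn

theorem mem_of_pair_mem {X a b : ZFSet.{u}} (hX : X.IsTransitive) (h : ZFSet.pair a b ∈ X) :
    a ∈ X ∧ b ∈ X := by
  have h1 : ({a, b} : ZFSet.{u}) ∈ X := hX _ h (by simp [ZFSet.pair])
  exact ⟨hX _ h1 (by simp), hX _ h1 (by simp)⟩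

theorem Dfn.isFunction {X : ZFSet.{u}} (hX : X.IsTransitive) (i : ℕ) :
    Dfn X (fun v => IsFunction (v i)) := by
  refine ((ball hX (i := i) (R := fun z _ => ∃ a ∈ X, ∃ b ∈ X, z = ZFSet.pair a b)
    (exists_mem (R := fun a v => ∃ b ∈ X, v 0 = ZFSet.pair a b)
      (exists_mem (R := fun b v => v 1 = ZFSet.pair (v 0) b) (eq_pair hX 2 1 0)))).and
    (forall_mem (R := fun a v => ∀ b ∈ X, ∀ c ∈ X, ZFSet.pair a b ∈ v i → ZFSet.pair a c ∈ v i →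
      b = c) (forall_mem (R := fun b v => ∀ c ∈ X, ZFSet.pair (v 0) b ∈ v (i + 1) →
        ZFSet.pair (v 0) c ∈ v (i + 1) → b = c)
        (forall_mem (R := fun c v => ZFSet.pair (v 1) (v 0) ∈ v (i + 2) →
          ZFSet.pair (v 1) c ∈ v (i + 2) → v 0 = c)
          ((pair_mem hX (i + 3) 2 1).imp ((pair_mem hX (i + 3) 2 0).imp (eq 1 0))))))).congr
    fun v hv => ?_
  constructor
  · rintro ⟨h1, h2⟩
    refine ⟨fun z hz => ?_, fun a _ b _ c _ => h2 a b c⟩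
    obtain ⟨a, b, rfl⟩ := h1 z hz
    obtain ⟨ha, hb⟩ := mem_of_pair_mem hX (hX _ (hv i) hz)
    exact ⟨a, ha, b, hb, rfl⟩
  · rintro ⟨h1, h2⟩
    refine ⟨fun z hz => ?_, fun a b c h h' => ?_⟩
    · obtain ⟨a, -, b, -, h⟩ := h1 z hz
      exact ⟨a, b, h⟩
    · obtain ⟨ha, hb⟩ := mem_of_pair_mem hX (hX _ (hv i) h)
      exact h2 a ha b hb c (mem_of_pair_mem hX (hX _ (hv i) h')).2 h h'

/-! ### The Tarski-Vaught criterion and Skolem functions -/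

/-- The only form in which elementarity of a submodel is used below: a definable existence statement
with parameters in `M` has a witness in `M`. -/
theorem Elementary.exists_mem {M X : ZFSet.{u}} (hM : Elementary M X)
    {R : ZFSet.{u} → (ℕ → ZFSet.{u}) → Prop}
    (hR : Dfn X (fun v => R (v 0) (fun n => v (n + 1)))) {v : ℕ → ZFSet.{u}}
    (hv : ∀ n, v n ∈ M) (h : ∃ x ∈ X, R x v) : ∃ x ∈ M, R x v := by
  obtain ⟨j, hj⟩ := hM
  obtain ⟨φ, hφ⟩ := hR
  let e : ℕ → ℕ ⊕ Unit := fun n => Nat.casesOn n (Sum.inr ()) Sum.inl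
  let ψ : setLang.Formula ℕ := (φ.relabel e).iExs Unit
  let w : ℕ → {x : ZFSet.{u} // x ∈ M} := fun n => ⟨v n, hv n⟩
  have hs : ∀ n, (j (w n)).1 = v n := fun n => hj (w n)
  have h1 : ψ.Realize (j ∘ w) := by
    rw [Language.Formula.realize_iExs]
    obtain ⟨x, hx, h⟩ := h
    refine ⟨fun _ => ⟨x, hx⟩, ?_⟩
    rw [Language.Formula.realize_relabel, hφ]
    simpa [e, hs] using h
  rw [j.map_formula, Language.Formula.realize_iExs] at h1
  obtain ⟨i, hi⟩ := h1
  refine ⟨(i ()).1, (i ()).2, ?_⟩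
  rw [Language.Formula.realize_relabel, ← j.map_formula, hφ] at hi
  simpa [e, hs, hj, w] using hi

theorem elementary_of_exists_mem {M X : ZFSet.{u}} (hMX : M ⊆ X)
    (h : ∀ (n : ℕ) (R : (Fin n ⊕ Unit → ZFSet.{u}) → Prop), Dfn X R → ∀ a : Fin n → ZFSet.{u},
      (∀ i, a i ∈ M) → (∃ y ∈ X, R (Sum.elim a fun _ => y)) →
        ∃ y ∈ M, R (Sum.elim a fun _ => y)) : Elementary M X := by
  let f : {x : ZFSet.{u} // x ∈ M} ↪[setLang] {x : ZFSet.{u} // x ∈ X} :=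
    { toFun := fun x => ⟨x.1, hMX x.2⟩
      inj' := fun x y hxy => Subtype.ext (congrArg (fun z => z.1) hxy)
      map_fun' := fun g => Empty.elim g
      map_rel' := by
        rintro n ⟨⟩ x
        rfl }
  refine ⟨f.toElementaryEmbedding fun n φ x a hφ => ?_, fun _ => rfl⟩
  let e : Empty ⊕ Fin (n + 1) → Fin n ⊕ Unit :=
    Sum.elim Empty.elim (Fin.lastCases (Sum.inr ()) Sum.inl)
  -- The formula has a meaning only for values in `X`, so membership in `X` is made part of the
  -- relation.
  let R : (Fin n ⊕ Unit → ZFSet.{u}) → Prop := fun v => ∃ hv : ∀ i, v i ∈ X,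
    (φ.toFormula.relabel e).Realize (fun i => (⟨v i, hv i⟩ : {x : ZFSet.{u} // x ∈ X}))
  have hR : Dfn X R := ⟨φ.toFormula.relabel e, fun v =>
    ⟨fun h => ⟨fun i => (v i).2, h⟩, fun ⟨_, h⟩ => h⟩⟩
  have key : ∀ b : {x : ZFSet.{u} // x ∈ X},
      φ.Realize default (Fin.snoc (f ∘ x) b : _ → {x : ZFSet.{u} // x ∈ X}) ↔
      R (Sum.elim (fun i => (x i).1) fun _ => b.1) := by
    intro b
    have hv : ∀ i, (Sum.elim (fun i => (x i).1) (fun _ => b.1) : Fin n ⊕ Unit → ZFSet.{u}) i ∈ X :=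
      Sum.rec (fun i => hMX (x i).2) (fun _ => b.2)
    simp only [R, exists_prop_of_true hv]
    rw [Language.Formula.realize_relabel, Language.BoundedFormula.realize_toFormula]
    have h1 : (Fin.snoc (f ∘ x) b : Fin (n + 1) → {x : ZFSet.{u} // x ∈ X}) =
        (((fun i => ⟨_, hv i⟩ : Fin n ⊕ Unit → {x : ZFSet.{u} // x ∈ X}) ∘ e) ∘ Sum.inr) := by
      funext i
      refine Fin.lastCases ?_ (fun i => ?_) i
      · simp [e]
      · simp only [Fin.snoc_castSucc, Function.comp_apply, e, Sum.elim_inr, Fin.lastCases_castSucc]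
        rfl
    rw [h1, Subsingleton.elim (default : Empty → {x : ZFSet.{u} // x ∈ X})]
  obtain ⟨y, hy, h1⟩ := h n R hR (fun i => (x i).1) (fun i => (x i).2) ⟨a.1, a.2, (key a).1 hφ⟩
  exact ⟨⟨y, hy⟩, (key (f ⟨y, hy⟩)).2 h1⟩

instance : Countable setLang.Symbols := by
  have h1 : ∀ l, Countable (setLang.Functions l) := fun l => inferInstanceAs (Countable Empty)
  have h2 : ∀ l, Countable (setLang.Relations l) := fun l =>
    (show Function.Injective (fun _ : SetRel l => ()) by rintro ⟨⟩ ⟨⟩ _; rfl).countable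
  exact inferInstanceAs (Countable ((Σ l, setLang.Functions l) ⊕ (Σ l, setLang.Relations l)))

open Classical in
/-- Skolem functions for `(X, ∈)`, with finite lists of arguments. -/
def skolem (X : ZFSet.{u}) (l : List ZFSet.{u}) : Set ZFSet.{u} :=
  Set.range fun φ : setLang.Formula (Fin l.length ⊕ Unit) =>
    if h : ∃ y, ∃ hv : ∀ i, (Sum.elim l.get (fun _ => y) : _ → ZFSet.{u}) i ∈ X,
      φ.Realize (fun i => (⟨_, hv i⟩ : {x : ZFSet.{u} // x ∈ X})) then h.choose else ∅

theorem skolem_countable (X : ZFSet.{u}) (l : List ZFSet.{u}) : (skolem X l).Countable :=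
  Set.countable_range _

theorem elementary_of_skolem {X : ZFSet.{u}} {A : Set ZFSet.{u}}
    (hA : ∀ l : List ZFSet.{u}, (∀ x ∈ l, x ∈ A) → skolem X l ⊆ A) :
    Elementary (ZFSet.sep (· ∈ A) X) X := by
  refine elementary_of_exists_mem ZFSet.sep_subset fun n R hR a ha => ?_
  rintro ⟨y, hy, h⟩
  obtain ⟨φ, hφ⟩ := hR
  obtain ⟨l, hl, rfl⟩ : ∃ l : List ZFSet.{u}, ∃ h : l.length = n, a = fun i => l.get (i.cast h.symm) :=
    ⟨List.ofFn a, List.length_ofFn, by funext i; simp⟩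
  subst hl
  have ha' : ∀ i, l.get i ∈ X ∧ l.get i ∈ A := fun i => ZFSet.mem_sep.1 (ha i)
  have hex : ∃ y, ∃ hv : ∀ i, (Sum.elim l.get (fun _ => y) : _ → ZFSet.{u}) i ∈ X,
      φ.Realize (fun i => (⟨_, hv i⟩ : {x : ZFSet.{u} // x ∈ X})) := by
    refine ⟨y, Sum.rec (fun i => (ha' i).1) (fun _ => hy), ?_⟩
    rw [hφ]
    exact h
  obtain ⟨hv, h1⟩ := hex.choose_spec
  refine ⟨hex.choose, ZFSet.mem_sep.2 ⟨hv (Sum.inr ()), ?_⟩, ?_⟩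
  · refine hA l (fun x hx => ?_) ⟨φ, dif_pos hex⟩
    obtain ⟨i, rfl⟩ := List.get_of_mem hx
    exact (ha' i).2
  · rw [hφ] at h1
    exact h1

/-! ### Closure properties of `H θ` -/

theorem push_mem {M x : ZFSet.{u}} {v : ℕ → ZFSet.{u}} (hx : x ∈ M) (hv : ∀ n, v n ∈ M) :
    ∀ n, push x v n ∈ M
  | 0 => hx
  | n + 1 => hv n

theorem card_le_of_surjOn {a b : ZFSet.{u}} (g : ZFSet.{u} → ZFSet.{u})
    (h : ∀ y ∈ b, ∃ x ∈ a, g x = y) : b.card ≤ a.card := by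
  let i : ZFSet.Definable₁ g := Classical.allZFSetDefinable fun s => g (s 0)
  refine le_trans (ZFSet.card_mono fun y hy => ?_) (ZFSet.card_image_le (f := g) (x := a))
  rw [ZFSet.mem_image]
  exact h y hy

theorem countable_iff_card_le {x : ZFSet.{u}} :
    (x : Set ZFSet.{u}).Countable ↔ x.card ≤ Cardinal.aleph0 := by
  rw [← Cardinal.le_aleph0_iff_set_countable]
  change Cardinal.mk x ≤ _ ↔ _
  rw [ZFSet.cardinalMk_coe_sort, Cardinal.lift_le_aleph0]

theorem finite_iff_card_lt {x : ZFSet.{u}} :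
    (x : Set ZFSet.{u}).Finite ↔ x.card < Cardinal.aleph0 := by
  rw [← Cardinal.lt_aleph0_iff_set_finite]
  change Cardinal.mk x < _ ↔ _
  rw [ZFSet.cardinalMk_coe_sort, Cardinal.lift_lt_aleph0]

section HClosure

variable {θ : Cardinal.{u}}

theorem isTransitive_H (hθ : θ.IsRegular) : (H θ).IsTransitive :=
  fun _ hx _ hy => mem_H_of_mem hθ hx hy

theorem card_lt_of_mem_H (hθ : θ.IsRegular) {x : ZFSet.{u}} (hx : x ∈ H θ) : x.card < θ :=
  ((mem_H hθ).1 hx).self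

theorem mem_H_of_subset (hθ : θ.IsRegular) {x : ZFSet.{u}} (hx : x ⊆ H θ) (hc : x.card < θ) :
    x ∈ H θ :=
  (mem_H hθ).2 (ZFSet.hereditarily_iff.2 ⟨hc, fun _ hy => (mem_H hθ).1 (hx hy)⟩)

theorem mem_H_of_subset_mem (hθ : θ.IsRegular) {x y : ZFSet.{u}} (hy : y ∈ H θ) (hx : x ⊆ y) :
    x ∈ H θ :=
  mem_H_of_subset hθ (fun _ hz => mem_H_of_mem hθ hy (hx hz))
    ((ZFSet.card_mono hx).trans_lt (card_lt_of_mem_H hθ hy))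

theorem mem_H_of_countable (hθ : θ.IsRegular) (h : Cardinal.aleph0 < θ) {x : ZFSet.{u}}
    (hx : x ⊆ H θ) (hc : (x : Set ZFSet.{u}).Countable) : x ∈ H θ :=
  mem_H_of_subset hθ hx ((countable_iff_card_le.1 hc).trans_lt h)

theorem mem_H_of_finite (hθ : θ.IsRegular) {x : ZFSet.{u}}
    (hx : x ⊆ H θ) (hc : (x : Set ZFSet.{u}).Finite) : x ∈ H θ :=
  mem_H_of_subset hθ hx ((finite_iff_card_lt.1 hc).trans_le hθ.aleph0_le)

theorem empty_mem_H (hθ : θ.IsRegular) : (∅ : ZFSet.{u}) ∈ H θ :=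
  mem_H_of_finite hθ (ZFSet.empty_subset _) (by simp)

theorem insert_mem_H (hθ : θ.IsRegular) {x y : ZFSet.{u}} (hx : x ∈ H θ) (hy : y ∈ H θ) :
    insert x y ∈ H θ := by
  refine mem_H_of_subset hθ (fun z hz => ?_) ?_
  · rcases ZFSet.mem_insert_iff.1 hz with rfl | hz
    exacts [hx, mem_H_of_mem hθ hy hz]
  · exact ZFSet.card_insert_le.trans_lt (Cardinal.add_lt_of_lt hθ.aleph0_le
      (card_lt_of_mem_H hθ hy) (Cardinal.one_lt_aleph0.trans_le hθ.aleph0_le))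

theorem singleton_mem_H (hθ : θ.IsRegular) {x : ZFSet.{u}} (hx : x ∈ H θ) : {x} ∈ H θ := by
  rw [← insert_empty_eq]
  exact insert_mem_H hθ hx (empty_mem_H hθ)

theorem pair_mem_H (hθ : θ.IsRegular) {x y : ZFSet.{u}} (hx : x ∈ H θ) (hy : y ∈ H θ) :
    ZFSet.pair x y ∈ H θ :=
  insert_mem_H hθ (singleton_mem_H hθ hx) (singleton_mem_H hθ
    (insert_mem_H hθ hx (singleton_mem_H hθ hy)))

theorem sUnion_mem_H (hθ : θ.IsRegular) {x : ZFSet.{u}} (hx : x ∈ H θ) : ZFSet.sUnion x ∈ H θ := by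
  refine mem_H_of_subset hθ (fun z hz => ?_) ?_
  · obtain ⟨y, hy, hz⟩ := ZFSet.mem_sUnion.1 hz
    exact mem_H_of_mem hθ (mem_H_of_mem hθ hx hy) hz
  · let f : Shrink.{u} x → ZFSet.{u} := fun i => ((equivShrink x).symm i).1
    have h1 : ZFSet.sUnion x ⊆ ZFSet.iUnion f := by
      intro z hz
      obtain ⟨y, hy, hz⟩ := ZFSet.mem_sUnion.1 hz
      exact ZFSet.mem_iUnion.2 ⟨equivShrink x ⟨y, hy⟩, by simpa [f] using hz⟩
    refine (ZFSet.card_mono h1).trans_lt ?_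
    have h2 := ZFSet.lift_card_iUnion_le_sum_card (f := f)
    rw [Cardinal.lift_id] at h2
    refine h2.trans_lt (Cardinal.sum_lt_of_isRegular hθ (card_lt_of_mem_H hθ hx) fun i => ?_)
    exact card_lt_of_mem_H hθ (mem_H_of_mem hθ hx ((equivShrink x).symm i).2)

/-- The graph of `g` on `A`. -/
def graphOn (A : ZFSet.{u}) (g : ZFSet.{u} → ZFSet.{u}) : ZFSet.{u} :=
  @ZFSet.image (fun x => ZFSet.pair x (g x))
    (Classical.allZFSetDefinable fun s => ZFSet.pair (s 0) (g (s 0))) A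

theorem mem_graphOn {A : ZFSet.{u}} {g : ZFSet.{u} → ZFSet.{u}} {z : ZFSet.{u}} :
    z ∈ graphOn A g ↔ ∃ x ∈ A, ZFSet.pair x (g x) = z :=
  @ZFSet.mem_image _ (_) _ _

theorem pair_mem_graphOn {A : ZFSet.{u}} {g : ZFSet.{u} → ZFSet.{u}} {x y : ZFSet.{u}} :
    ZFSet.pair x y ∈ graphOn A g ↔ x ∈ A ∧ y = g x := by
  rw [mem_graphOn]
  constructor
  · rintro ⟨x', hx, h⟩
    obtain ⟨rfl, rfl⟩ := ZFSet.pair_inj.1 h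
    exact ⟨hx, rfl⟩
  · rintro ⟨hx, rfl⟩
    exact ⟨x, hx, rfl⟩

theorem isFunction_graphOn (A : ZFSet.{u}) (g : ZFSet.{u} → ZFSet.{u}) :
    IsFunction (graphOn A g) := by
  refine ⟨fun z hz => ?_, fun a b c hb hc => ?_⟩
  · obtain ⟨x, -, rfl⟩ := mem_graphOn.1 hz
    exact ⟨_, _, rfl⟩
  · rw [(pair_mem_graphOn.1 hb).2, (pair_mem_graphOn.1 hc).2]

theorem graphOn_mem_H (hθ : θ.IsRegular) {A : ZFSet.{u}} {g : ZFSet.{u} → ZFSet.{u}}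
    (hA : A ∈ H θ) (hg : ∀ x ∈ A, g x ∈ H θ) : graphOn A g ∈ H θ := by
  refine mem_H_of_subset hθ (fun z hz => ?_) ?_
  · obtain ⟨x, hx, rfl⟩ := mem_graphOn.1 hz
    exact pair_mem_H hθ (mem_H_of_mem hθ hA hx) (hg x hx)
  · exact (card_le_of_surjOn _ fun z hz => mem_graphOn.1 hz).trans_lt (card_lt_of_mem_H hθ hA)

theorem prod_mem_H (hθ : θ.IsRegular) {A B : ZFSet.{u}} (hA : A ∈ H θ) (hB : B ∈ H θ) :
    ZFSet.prod A B ∈ H θ := by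
  refine mem_H_of_subset hθ (fun z hz => ?_) ?_
  · obtain ⟨a, ha, b, hb, rfl⟩ := ZFSet.mem_prod.1 hz
    exact pair_mem_H hθ (mem_H_of_mem hθ hA ha) (mem_H_of_mem hθ hB hb)
  · let f : A × B → (ZFSet.prod A B : ZFSet.{u}) := fun p =>
      ⟨ZFSet.pair p.1.1 p.2.1, ZFSet.pair_mem_prod.2 ⟨p.1.2, p.2.2⟩⟩
    have hf : Function.Surjective f := by
      rintro ⟨z, hz⟩
      obtain ⟨a, ha, b, hb, rfl⟩ := ZFSet.mem_prod.1 hz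
      exact ⟨(⟨a, ha⟩, ⟨b, hb⟩), rfl⟩
    have h1 := Cardinal.mk_le_of_surjective hf
    rw [Cardinal.mk_prod, Cardinal.lift_id, Cardinal.lift_id, ZFSet.cardinalMk_coe_sort,
      ZFSet.cardinalMk_coe_sort, ZFSet.cardinalMk_coe_sort, ← Cardinal.lift_mul,
      Cardinal.lift_le] at h1
    exact h1.trans_lt (Cardinal.mul_lt_of_lt hθ.aleph0_le (card_lt_of_mem_H hθ hA)
      (card_lt_of_mem_H hθ hB))

/-- The set `ω` of natural numbers. -/
def omegaSet : ZFSet.{u} := Ordinal.toZFSet Ordinal.omega0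

theorem mem_omegaSet {x : ZFSet.{u}} : x ∈ omegaSet ↔ ∃ n : ℕ, Ordinal.toZFSet n = x := by
  rw [omegaSet, Ordinal.mem_toZFSet_iff]
  constructor
  · rintro ⟨a, ha, rfl⟩
    obtain ⟨n, rfl⟩ := Ordinal.lt_omega0.1 ha
    exact ⟨n, rfl⟩
  · rintro ⟨n, rfl⟩
    exact ⟨n, Ordinal.natCast_lt_omega0 n, rfl⟩

theorem toZFSet_nat_succ (n : ℕ) : Ordinal.toZFSet ((n + 1 : ℕ) : Ordinal.{u}) =
    insert (Ordinal.toZFSet n) (Ordinal.toZFSet n) := by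
  rw [Nat.cast_succ, Ordinal.toZFSet_add_one]

theorem toZFSet_mem_H (hθ : θ.IsRegular) {o : Ordinal.{u}} (ho : o.card < θ) :
    o.toZFSet ∈ H θ := by
  induction o using WellFoundedLT.induction with
  | ind o ih =>
    refine mem_H_of_subset hθ (fun x hx => ?_) (by rwa [Ordinal.card_toZFSet])
    obtain ⟨a, ha, rfl⟩ := Ordinal.mem_toZFSet_iff.1 hx
    exact ih a ha ((Ordinal.card_le_card ha.le).trans_lt ho)

theorem nat_mem_H (hθ : θ.IsRegular) (n : ℕ) : Ordinal.toZFSet (n : Ordinal.{u}) ∈ H θ :=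
  toZFSet_mem_H hθ (by rw [Ordinal.card_nat]; exact hθ.nat_lt n)

theorem omegaSet_mem_H (hθ : θ.IsRegular) (h : Cardinal.aleph0 < θ) : omegaSet ∈ H θ :=
  toZFSet_mem_H hθ (by rwa [Ordinal.card_omega0])

theorem card_le_aleph0_of_mem_om1 {x : ZFSet.{u}} (hx : x ∈ om1) :
    ∃ a : Ordinal.{u}, a < Ordinal.omega 1 ∧ a.card ≤ Cardinal.aleph0 ∧ a.toZFSet = x := by
  obtain ⟨a, ha, rfl⟩ := Ordinal.mem_toZFSet_iff.1 hx
  refine ⟨a, ha, ?_, rfl⟩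
  rwa [← Cardinal.ord_aleph, Cardinal.lt_ord, ← zero_add 1, ← Cardinal.succ_aleph,
    Cardinal.aleph_zero, Order.lt_succ_iff] at ha

theorem om1_subset_H (hθ : θ.IsRegular) (h : Cardinal.aleph0 < θ) : om1 ⊆ H θ := by
  intro x hx
  obtain ⟨a, -, ha, rfl⟩ := card_le_aleph0_of_mem_om1 hx
  exact toZFSet_mem_H hθ (ha.trans_lt h)

end HClosure

/-! ### Closure properties of elementary submodels of `H θ` -/

theorem card_Hull_le (M x : ZFSet.{u}) : (Hull M x).card ≤ M.card := by
  classical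
  refine card_le_of_surjOn (fun f => if h : ∃ y, ZFSet.pair x y ∈ f then h.choose else ∅)
    fun y hy => ?_
  obtain ⟨f, hf, hfun, hp⟩ := mem_Hull.1 hy
  have h : ∃ y, ZFSet.pair x y ∈ f := ⟨y, hp⟩
  exact ⟨f, hf, by rw [dif_pos h]; exact hfun.2 _ _ _ h.choose_spec hp⟩

theorem Hull_subset_of_subset {X M x : ZFSet.{u}} (hX : X.IsTransitive) (hM : M ⊆ X) :
    Hull M x ⊆ X := by
  intro y hy
  obtain ⟨f, hf, -, hp⟩ := mem_Hull.1 hy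
  exact (mem_of_pair_mem hX (hX _ (hM hf) hp)).2

theorem Hull_mono {M N : ZFSet.{u}} (h : M ⊆ N) (x : ZFSet.{u}) : Hull M x ⊆ Hull N x := by
  intro y hy
  obtain ⟨f, hf, hp⟩ := mem_Hull.1 hy
  exact mem_Hull.2 ⟨f, h hf, hp⟩

theorem countable_Hull {M : ZFSet.{u}} (hM : (M : Set ZFSet.{u}).Countable) (x : ZFSet.{u}) :
    (Hull M x : Set ZFSet.{u}).Countable :=
  countable_iff_card_le.2 ((card_Hull_le M x).trans (countable_iff_card_le.1 hM))

namespace Elementary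

variable {θ : Cardinal.{u}} {M : ZFSet.{u}}

theorem insert_mem (hM : Elementary M (H θ)) (hθ : θ.IsRegular) {a b : ZFSet.{u}} (ha : a ∈ M)
    (hb : b ∈ M) : insert a b ∈ M := by
  obtain ⟨x, hx, h⟩ := hM.exists_mem (R := fun x v => x = insert (v 0) (v 1))
    (.eq_insert (isTransitive_H hθ) 0 1 2) (push_mem ha fun _ => hb)
    ⟨_, insert_mem_H hθ (hM.subset ha) (hM.subset hb), rfl⟩
  exact (show x = insert a b from h) ▸ hx

theorem fst_mem (hM : Elementary M (H θ)) (hθ : θ.IsRegular) {a b : ZFSet.{u}}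
    (h : ZFSet.pair a b ∈ M) : a ∈ M := by
  have hX := isTransitive_H hθ
  obtain ⟨ha, hb⟩ := mem_of_pair_mem hX (hM.subset h)
  obtain ⟨x, hx, y, -, h⟩ := hM.exists_mem (R := fun x v => ∃ y ∈ H θ, v 0 = ZFSet.pair x y)
    (.exists_mem (R := fun y v => v 1 = ZFSet.pair (v 0) y) (.eq_pair hX 2 1 0)) (fun _ => h)
    ⟨a, ha, b, hb, rfl⟩
  exact (ZFSet.pair_inj.1 h).1 ▸ hx

theorem snd_mem (hM : Elementary M (H θ)) (hθ : θ.IsRegular) {a b : ZFSet.{u}}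
    (h : ZFSet.pair a b ∈ M) : b ∈ M := by
  have hX := isTransitive_H hθ
  obtain ⟨ha, hb⟩ := mem_of_pair_mem hX (hM.subset h)
  obtain ⟨x, hx, y, -, h⟩ := hM.exists_mem (R := fun x v => ∃ y ∈ H θ, v 0 = ZFSet.pair y x)
    (.exists_mem (R := fun y v => v 1 = ZFSet.pair y (v 0)) (.eq_pair hX 2 0 1)) (fun _ => h)
    ⟨b, hb, a, ha, rfl⟩
  exact (ZFSet.pair_inj.1 h).2 ▸ hx

theorem apply_mem (hM : Elementary M (H θ)) (hθ : θ.IsRegular) {f x y : ZFSet.{u}} (hf : f ∈ M)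
    (hfun : IsFunction f) (hx : x ∈ M) (hp : ZFSet.pair x y ∈ f) : y ∈ M := by
  have hX := isTransitive_H hθ
  obtain ⟨z, hz, h⟩ := hM.exists_mem (R := fun y v => ZFSet.pair (v 1) y ∈ v 0)
    (.pair_mem hX 1 2 0) (push_mem hf fun _ => hx)
    ⟨y, (mem_of_pair_mem hX (hX _ (hM.subset hf) hp)).2, hp⟩
  exact hfun.2 x z y h hp ▸ hz

theorem Hull_subset (hM : Elementary M (H θ)) (hθ : θ.IsRegular) {x : ZFSet.{u}} (hx : x ∈ M) :
    Hull M x ⊆ M := by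
  intro y hy
  obtain ⟨f, hf, hfun, hp⟩ := mem_Hull.1 hy
  exact hM.apply_mem hθ hf hfun hx hp

/-- The element `y` is the value at `x` of a function in `M` that is constantly `y` on `A`. -/
theorem subset_Hull (hM : Elementary M (H θ)) (hθ : θ.IsRegular) {A x : ZFSet.{u}} (hA : A ∈ M)
    (hx : x ∈ A) : M ⊆ Hull M x := by
  intro y hy
  have hX := isTransitive_H hθ
  obtain ⟨c, hc, h1, h2⟩ := hM.exists_mem
    (R := fun c v => IsFunction c ∧ ∀ x ∈ v 0, ZFSet.pair x (v 1) ∈ c)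
    (.and (.isFunction hX 0) (.ball hX (R := fun x v => ZFSet.pair x (v 2) ∈ v 0) (i := 1)
      (.pair_mem hX 1 0 3))) (push_mem hA fun _ => hy)
    ⟨graphOn A fun _ => y, graphOn_mem_H hθ (hM.subset hA) fun _ _ => hM.subset hy,
      isFunction_graphOn _ _, fun x hx => pair_mem_graphOn.2 ⟨hx, rfl⟩⟩
  exact mem_Hull.2 ⟨c, hc, h1, h2 x hx⟩

theorem empty_mem (hM : Elementary M (H θ)) (hθ : θ.IsRegular) {a : ZFSet.{u}} (ha : a ∈ M) :
    ∅ ∈ M := by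
  obtain ⟨x, hx, h⟩ := hM.exists_mem (R := fun x _ => x = ∅) (.isEmpty (isTransitive_H hθ) 0)
    (fun _ => ha) ⟨_, empty_mem_H hθ, rfl⟩
  exact h ▸ hx

theorem nat_mem (hM : Elementary M (H θ)) (hθ : θ.IsRegular) {a : ZFSet.{u}} (ha : a ∈ M)
    (n : ℕ) : Ordinal.toZFSet (n : Ordinal.{u}) ∈ M := by
  induction n with
  | zero => simpa using hM.empty_mem hθ ha
  | succ n ih => rw [toZFSet_nat_succ]; exact hM.insert_mem hθ ih ih

theorem infinite (hM : Elementary M (H θ)) (hθ : θ.IsRegular) {a : ZFSet.{u}} (ha : a ∈ M) :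
    (M : Set ZFSet.{u}).Infinite :=
  Set.infinite_of_injective_forall_mem (f := fun n : ℕ => Ordinal.toZFSet (n : Ordinal.{u}))
    (fun m n h => by exact_mod_cast Ordinal.toZFSet_injective h) fun n => hM.nat_mem hθ ha n

theorem mem_of_finite_subset (hM : Elementary M (H θ)) (hθ : θ.IsRegular) {a : ZFSet.{u}}
    (ha : a ∈ M) {x : ZFSet.{u}} (hx : x ⊆ M) (hfin : (x : Set ZFSet.{u}).Finite) : x ∈ M := by
  suffices h : ∀ s : Set ZFSet.{u}, s.Finite → s ⊆ M → ∃ y ∈ M, (y : Set ZFSet.{u}) = s by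
    obtain ⟨y, hy, h1⟩ := h _ hfin hx
    rwa [← SetLike.coe_injective h1]
  intro s hs
  induction s, hs using Set.Finite.induction_on with
  | empty => exact fun _ => ⟨∅, hM.empty_mem hθ ha, by simp⟩
  | @insert b s _ _ ih =>
    intro h
    obtain ⟨y, hy, h1⟩ := ih fun z hz => h (Or.inr hz)
    exact ⟨insert b y, hM.insert_mem hθ (h (Or.inl rfl)) hy, by simp [h1]⟩

/-- By foundation, `ω` is the only set that contains `∅`, is closed under successor and consists of
`∅` and successors of its own elements; these clauses are bounded. -/
theorem omegaSet_mem (hM : Elementary M (H θ)) (hθ : θ.IsRegular) (h0 : Cardinal.aleph0 < θ)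
    {a : ZFSet.{u}} (ha : a ∈ M) : omegaSet ∈ M := by
  have hX := isTransitive_H hθ
  obtain ⟨w, hw, ⟨z, hz, rfl⟩, h1, h2⟩ := hM.exists_mem
    (R := fun w _ => (∃ z ∈ w, z = ∅) ∧ (∀ n ∈ w, ∃ m ∈ w, m = insert n n) ∧
      ∀ n ∈ w, n = ∅ ∨ ∃ m ∈ w, n = insert m m)
    (.and (.bex hX (R := fun z _ => z = ∅) (i := 0) (.isEmpty hX 0))
      (.and (.ball hX (R := fun n v => ∃ m ∈ v 0, m = insert n n) (i := 0)
        (.bex hX (R := fun m v => m = insert (v 0) (v 0)) (i := 1) (.eq_insert hX 0 1 1)))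
      (.ball hX (R := fun n v => n = ∅ ∨ ∃ m ∈ v 0, n = insert m m) (i := 0)
        (.or (.isEmpty hX 0) (.bex hX (R := fun m v => v 0 = insert m m) (i := 1)
          (.eq_insert hX 1 0 0)))))) (fun _ => ha)
    ⟨omegaSet, omegaSet_mem_H hθ h0, ⟨∅, mem_omegaSet.2 ⟨0, by simp⟩, rfl⟩, by
      intro n hn
      obtain ⟨k, rfl⟩ := mem_omegaSet.1 hn
      exact ⟨_, mem_omegaSet.2 ⟨k + 1, rfl⟩, toZFSet_nat_succ k⟩, by
      intro n hn
      obtain ⟨k, rfl⟩ := mem_omegaSet.1 hn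
      cases k with
      | zero => exact Or.inl (by simp)
      | succ k =>
        exact Or.inr ⟨Ordinal.toZFSet k, mem_omegaSet.2 ⟨k, rfl⟩, toZFSet_nat_succ k⟩⟩
  have hnat : ∀ k : ℕ, Ordinal.toZFSet (k : Ordinal.{u}) ∈ w := by
    intro k
    induction k with
    | zero => simpa using hz
    | succ k ih =>
      obtain ⟨m, hm, rfl⟩ := h1 _ ih
      rwa [toZFSet_nat_succ]
  have hsub : ∀ n, n ∈ w → n ∈ omegaSet := by
    intro n
    refine ZFSet.inductionOn n fun n ih hn => ?_
    rcases h2 n hn with rfl | ⟨m, hm, rfl⟩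
    · exact mem_omegaSet.2 ⟨0, by simp⟩
    · obtain ⟨k, rfl⟩ := mem_omegaSet.1 (ih m (ZFSet.mem_insert _ _) hm)
      exact mem_omegaSet.2 ⟨k + 1, toZFSet_nat_succ k⟩
  have hw' : w = omegaSet := ZFSet.ext fun n => ⟨hsub n, fun hn => by
    obtain ⟨k, rfl⟩ := mem_omegaSet.1 hn
    exact hnat k⟩
  exact hw' ▸ hw

theorem exists_enumeration {X c : ZFSet.{u}} (hne : ∃ x, x ∈ c)
    (hc : (c : Set ZFSet.{u}).Countable) (hX : ∀ x ∈ c, ∀ n : ℕ,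
      ZFSet.pair (Ordinal.toZFSet (n : Ordinal.{u})) x ∈ X) :
    ∃ e, e ⊆ X ∧ (e : Set ZFSet.{u}).Countable ∧ IsFunction e ∧
      ∀ x ∈ c, ∃ n ∈ omegaSet, ZFSet.pair n x ∈ e := by
  obtain ⟨f, hf⟩ := hc.exists_eq_range hne
  have hfc : ∀ n, f n ∈ c := fun n => by
    have : f n ∈ (c : Set ZFSet.{u}) := hf ▸ ⟨n, rfl⟩
    exact this
  refine ⟨ZFSet.range fun n : ℕ => ZFSet.pair (Ordinal.toZFSet (n : Ordinal.{u})) (f n),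
    fun z hz => ?_, ?_, ⟨fun z hz => ?_, fun a b d hb hd => ?_⟩, fun x hx => ?_⟩
  · obtain ⟨n, rfl⟩ := ZFSet.mem_range.1 hz
    exact hX _ (hfc n) n
  · rw [ZFSet.coe_range]
    exact Set.countable_range _
  · obtain ⟨n, rfl⟩ := ZFSet.mem_range.1 hz
    exact ⟨_, _, rfl⟩
  · obtain ⟨n, hn⟩ := ZFSet.mem_range.1 hb
    obtain ⟨m, hm⟩ := ZFSet.mem_range.1 hd
    obtain ⟨rfl, rfl⟩ := ZFSet.pair_inj.1 hn
    obtain ⟨h1, rfl⟩ := ZFSet.pair_inj.1 hm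
    have h2 : m = n := by exact_mod_cast Ordinal.toZFSet_injective h1
    rw [h2]
  · have : x ∈ (c : Set ZFSet.{u}) := hx
    rw [hf] at this
    obtain ⟨n, rfl⟩ := this
    exact ⟨_, mem_omegaSet.2 ⟨n, rfl⟩, ZFSet.mem_range.2 ⟨n, rfl⟩⟩

/-- `M` contains a function whose values on `ω` cover `c`, and it contains all natural numbers. -/
theorem subset_of_countable (hM : Elementary M (H θ)) (hθ : θ.IsRegular)
    (h0 : Cardinal.aleph0 < θ) {c : ZFSet.{u}} (hcM : c ∈ M) (hc : (c : Set ZFSet.{u}).Countable) :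
    c ⊆ M := by
  have hX := isTransitive_H hθ
  intro x hx
  obtain ⟨e, he, hec, hfun, hcov⟩ := exists_enumeration (X := H θ) ⟨x, hx⟩ hc fun x hx n =>
    pair_mem_H hθ (nat_mem_H hθ n) (hX _ (hM.subset hcM) hx)
  obtain ⟨e, heM, hfun, hcov⟩ := hM.exists_mem
    (R := fun e v => IsFunction e ∧ ∀ x ∈ v 0, ∃ n ∈ v 1, ZFSet.pair n x ∈ e)
    (.and (.isFunction hX 0) (.ball hX (i := 1)
      (R := fun x v => ∃ n ∈ v 2, ZFSet.pair n x ∈ v 0) (.bex hX (i := 3)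
        (R := fun n v => ZFSet.pair n (v 0) ∈ v 1) (.pair_mem hX 2 0 1))))
    (push_mem hcM fun _ => hM.omegaSet_mem hθ h0 hcM)
    ⟨e, mem_H_of_countable hθ h0 he hec, hfun, hcov⟩
  obtain ⟨n, hn, hp⟩ := hcov x hx
  obtain ⟨k, rfl⟩ := mem_omegaSet.1 hn
  exact hM.apply_mem hθ heM hfun (hM.nat_mem hθ hcM k) hp

/-- The hull is definable from `a` and `x` in `(H θ, ∈)` and is small enough to belong to `H θ`. -/
theorem Hull_mem (hM : Elementary M (H θ)) (hθ : θ.IsRegular) {a x : ZFSet.{u}} (ha : a ∈ M)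
    (hx : x ∈ M) : Hull a x ∈ M := by
  have hX := isTransitive_H hθ
  have hsub : Hull a x ⊆ H θ := Hull_subset_of_subset hX (hX _ (hM.subset ha))
  obtain ⟨h, hh, h1⟩ := hM.exists_mem (R := fun h v => ∀ y ∈ H θ, y ∈ h ↔
      ∃ f ∈ v 0, IsFunction f ∧ ZFSet.pair (v 1) y ∈ f)
    (.forall_mem (R := fun y v => y ∈ v 0 ↔ ∃ f ∈ v 1, IsFunction f ∧ ZFSet.pair (v 2) y ∈ f)
      (.iff (.mem 0 1) (.bex hX (R := fun f v => IsFunction f ∧ ZFSet.pair (v 3) (v 0) ∈ f)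
        (i := 2) (.and (.isFunction hX 0) (.pair_mem hX 0 4 1)))))
    (push_mem ha fun _ => hx)
    ⟨Hull a x, mem_H_of_subset hθ hsub
      ((card_Hull_le a x).trans_lt (card_lt_of_mem_H hθ (hM.subset ha))), fun y _ => mem_Hull⟩
  have : h = Hull a x := by
    ext y
    rw [mem_Hull]
    refine ⟨fun hy => (h1 y (hX _ (hM.subset hh) hy)).1 hy, fun hy => ?_⟩
    exact (h1 y (hsub (mem_Hull.2 hy))).2 hy
  exact this ▸ hh

end Elementary

theorem isOrdinal_of_subset {o x : ZFSet.{u}} (ho : o.IsOrdinal) (hx : x ⊆ o)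
    (ht : x.IsTransitive) : x.IsOrdinal :=
  ZFSet.isOrdinal_iff_forall_mem_isOrdinal.2 ⟨ht, fun _ hy => ho.mem (hx hy)⟩

theorem isOrdinal_om1 : om1.{u}.IsOrdinal := ZFSet.isOrdinal_toZFSet _

theorem mem_om1_of_isOrdinal {x : ZFSet.{u}} (hx : x.IsOrdinal) (hc : x.card ≤ Cardinal.aleph0) :
    x ∈ om1 := by
  rw [om1, ← hx.toZFSet_rank_eq, Ordinal.toZFSet_mem_toZFSet_iff, ← Cardinal.ord_aleph,
    Cardinal.lt_ord, ← zero_add 1, ← Cardinal.succ_aleph, Cardinal.aleph_zero,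
    Order.lt_succ_iff, ← Ordinal.card_toZFSet, hx.toZFSet_rank_eq]
  exact hc

theorem countable_of_mem_om1 {x : ZFSet.{u}} (hx : x ∈ om1) : (x : Set ZFSet.{u}).Countable := by
  obtain ⟨a, -, ha, rfl⟩ := card_le_aleph0_of_mem_om1 hx
  rwa [countable_iff_card_le, Ordinal.card_toZFSet]

namespace Elementary

variable {θ : Cardinal.{u}} {M N : ZFSet.{u}}

/-- The trace of a countable elementary submodel is a countable ordinal. -/
theorem trace_mem_om1 (hM : Elementary M (H θ)) (hθ : θ.IsRegular) (h0 : Cardinal.aleph0 < θ)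
    (hc : (M : Set ZFSet.{u}).Countable) : M ∩ om1 ∈ om1 := by
  refine mem_om1_of_isOrdinal (isOrdinal_of_subset isOrdinal_om1
    (fun x hx => (ZFSet.mem_inter.1 hx).2) fun x hx y hy => ?_) ?_
  · obtain ⟨h1, h2⟩ := ZFSet.mem_inter.1 hx
    exact ZFSet.mem_inter.2 ⟨hM.subset_of_countable hθ h0 h1 (countable_of_mem_om1 h2) hy,
      isOrdinal_om1.mem_trans hy h2⟩
  · exact (ZFSet.card_mono fun x hx => (ZFSet.mem_inter.1 hx).1).trans (countable_iff_card_le.1 hc)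

/-- The trace of `M` is a countable ordinal outside `M`, so by elementarity `N` contains some
countable ordinal outside `M`. As `ω₁` need not belong to `H θ`, countability is expressed by an
enumeration. -/
theorem trace_mem_trace (hM : Elementary M (H θ)) (hN : Elementary N (H θ)) (hθ : θ.IsRegular)
    (h0 : Cardinal.aleph0 < θ) (hMc : (M : Set ZFSet.{u}).Countable)
    (hNc : (N : Set ZFSet.{u}).Countable) (hMN : M ∈ N) : M ∩ om1 ∈ N ∩ om1 := by
  have hX := isTransitive_H hθ
  have hMo := hM.trace_mem_om1 hθ h0 hMc
  have hNo := hN.trace_mem_om1 hθ h0 hNc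
  have hsub : M ⊆ N := hN.subset_of_countable hθ h0 hMN hMc
  have hle : M ∩ om1 ⊆ N ∩ om1 := fun x hx =>
    ZFSet.mem_inter.2 ⟨hsub (ZFSet.mem_inter.1 hx).1, (ZFSet.mem_inter.1 hx).2⟩
  rcases ((isOrdinal_om1.mem hMo).subset_iff_eq_or_mem (isOrdinal_om1.mem hNo)).1 hle with heq | h
  swap
  · exact h
  exfalso
  have hδM : M ∩ om1 ∉ M := fun h => ZFSet.mem_irrefl _ (ZFSet.mem_inter.2 ⟨h, hMo⟩)
  have hord := isOrdinal_om1.mem hMo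
  have hempty : (∅ : ZFSet.{u}) ∈ M ∩ om1 := by
    rw [heq]
    exact ZFSet.mem_inter.2 ⟨hN.empty_mem hθ hMN,
      mem_om1_of_isOrdinal ZFSet.isOrdinal_empty (by simp)⟩
  obtain ⟨e, he, hec, hfun, hcov⟩ := exists_enumeration (X := H θ) (c := M ∩ om1) ⟨∅, hempty⟩
    (countable_of_mem_om1 hMo) fun x hx n =>
      pair_mem_H hθ (nat_mem_H hθ n) (om1_subset_H hθ h0 (ZFSet.mem_inter.1 hx).2)
  obtain ⟨x, hx, h1, h2, h3, e, -, h4, h5⟩ := hN.exists_mem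
    (R := fun x v => (∀ y ∈ x, ∀ z ∈ y, z ∈ x) ∧ (∀ y ∈ x, ∀ z ∈ y, ∀ t ∈ z, t ∈ y) ∧
      x ∉ v 0 ∧ ∃ e ∈ H θ, IsFunction e ∧ ∀ y ∈ x, ∃ n ∈ v 1, ZFSet.pair n y ∈ e)
    (.and (.ball hX (R := fun y v => ∀ z ∈ y, z ∈ v 0) (i := 0)
      (.ball hX (R := fun z v => z ∈ v 1) (i := 0) (.mem 0 2)))
    (.and (.ball hX (R := fun y _ => ∀ z ∈ y, ∀ t ∈ z, t ∈ y) (i := 0)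
      (.ball hX (R := fun z v => ∀ t ∈ z, t ∈ v 0) (i := 0)
        (.ball hX (R := fun t v => t ∈ v 1) (i := 0) (.mem 0 2))))
    (.and (.not (.mem 0 1)) (.exists_mem
      (R := fun e v => IsFunction e ∧ ∀ y ∈ v 0, ∃ n ∈ v 2, ZFSet.pair n y ∈ e)
      (.and (.isFunction hX 0) (.ball hX (R := fun y v => ∃ n ∈ v 3, ZFSet.pair n y ∈ v 0)
        (i := 1) (.bex hX (R := fun n v => ZFSet.pair n (v 0) ∈ v 1) (i := 4)
          (.pair_mem hX 2 0 1))))))))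
    (push_mem hMN fun _ => hN.omegaSet_mem hθ h0 hMN)
    ⟨M ∩ om1, om1_subset_H hθ h0 hMo, fun y hy z hz => hord.mem_trans hz hy,
      fun y hy z hz t ht => (hord.mem hy).mem_trans ht hz, hδM, e,
      mem_H_of_countable hθ h0 he hec, hfun, hcov⟩
  have hxo : x.IsOrdinal := ZFSet.isOrdinal_iff_forall_mem_isTransitive.2
    ⟨fun y hy z hz => h1 y hy z hz, fun y hy z hz t ht => h2 y hy z hz t ht⟩
  have hxc : x.card ≤ Cardinal.aleph0 := by
    classical
    have h6 : x.card ≤ omegaSet.{u}.card := by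
      refine card_le_of_surjOn (fun n => if h : ∃ y, ZFSet.pair n y ∈ e then h.choose else ∅)
        fun y hy => ?_
      obtain ⟨n, hn, hp⟩ := h5 y hy
      have h : ∃ y, ZFSet.pair n y ∈ e := ⟨y, hp⟩
      exact ⟨n, hn, by rw [dif_pos h]; exact h4.2 _ _ _ h.choose_spec hp⟩
    rwa [omegaSet, Ordinal.card_toZFSet, Ordinal.card_omega0] at h6
  have h7 : x ∈ M ∩ om1 := by
    rw [heq]
    exact ZFSet.mem_inter.2 ⟨hx, mem_om1_of_isOrdinal hxo hxc⟩
  exact h3 (ZFSet.mem_inter.1 h7).1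

end Elementary

/-! ### Hulls of elementary submodels -/

/-- The relation `R` evaluated at the values at `v p` of the functions `v r, v (r + 1), …` and
at `v q` is definable. -/
theorem Dfn.apply_functions {X : ZFSet.{u}} (hX : X.IsTransitive) {n : ℕ}
    {R : (Fin n ⊕ Unit → ZFSet.{u}) → Prop} (hR : Dfn X R) (p q r : ℕ) :
    Dfn X (fun v : ℕ → ZFSet.{u} => ∃ w : Fin n → ZFSet.{u}, (∀ i, w i ∈ X) ∧
      (∀ i : Fin n, ZFSet.pair (v p) (w i) ∈ v (i + r)) ∧ R (Sum.elim w fun _ => v q)) := by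
  have h1 : Dfn X (fun v : ℕ ⊕ Fin n → ZFSet.{u} =>
      (∀ i : Fin n, ZFSet.pair (v (Sum.inl p)) (v (Sum.inr i)) ∈ v (Sum.inl (i + r))) ∧
        R (fun a => v (Sum.elim Sum.inr (fun _ => Sum.inl q) a))) := by
    refine .and (.forall_finite fun i => ?_) (hR.relabel _)
    exact (Dfn.pair_mem hX 0 1 2).relabel fun k => match k with
      | 0 => Sum.inl (i + r)
      | 1 => Sum.inl p
      | _ => Sum.inr i
  refine h1.exists_finite.congr fun v _ => exists_congr fun w => and_congr_right fun _ =>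
    and_congr_right fun _ => iff_of_eq (congrArg R ?_)
  funext a
  cases a <;> rfl

/-- Tarski-Vaught: the parameters are values `g i` at `ξ` with `g i ∈ M`. A choice of witnesses,
made uniformly for all `x ∈ A`, is a function in `H θ`; hence `M` contains such a function, and its
value at `ξ` is the required witness. -/
theorem Elementary.elementary_Hull {θ : Cardinal.{u}} {M : ZFSet.{u}} (hM : Elementary M (H θ))
    (hθ : θ.IsRegular) {A ξ : ZFSet.{u}} (hA : A ∈ M) (hξ : ξ ∈ A) :
    Elementary (Hull M ξ) (H θ) := by
  classical
  have hX := isTransitive_H hθ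
  refine elementary_of_exists_mem (Hull_subset_of_subset hX hM.subset) fun n R hR a ha => ?_
  rintro ⟨y, hy, hRy⟩
  choose g hg hgfun hgp using fun i => mem_Hull.1 (ha i)
  let v : ℕ → ZFSet.{u} := push A fun i => if h : i < n then g ⟨i, h⟩ else A
  have hv : ∀ k, v k ∈ M := push_mem hA fun i => by
    split_ifs
    exacts [hg _, hA]
  have hvg : ∀ i : Fin n, v (i + 1) = g i := fun i => by simp [v, push]
  let T : ZFSet.{u} → ZFSet.{u} → (ℕ → ZFSet.{u}) → Prop := fun x y v =>
    ∃ w : Fin n → ZFSet.{u}, (∀ i, w i ∈ H θ) ∧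
      (∀ i : Fin n, ZFSet.pair x (w i) ∈ v (i + 1)) ∧ R (Sum.elim w fun _ => y)
  have hex : ∃ f ∈ H θ, IsFunction f ∧ ∀ x ∈ A, ∀ y ∈ H θ, T x y v →
      ∃ z ∈ H θ, ZFSet.pair x z ∈ f ∧ T x z v := by
    refine ⟨graphOn A fun x => if h : ∃ y ∈ H θ, T x y v then h.choose else ∅,
      graphOn_mem_H hθ (hM.subset hA) (fun x _ => ?_), isFunction_graphOn _ _,
      fun x hx y hy hT => ?_⟩
    · split_ifs with h
      exacts [h.choose_spec.1, empty_mem_H hθ]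
    · have h : ∃ y ∈ H θ, T x y v := ⟨y, hy, hT⟩
      exact ⟨h.choose, h.choose_spec.1, pair_mem_graphOn.2 ⟨hx, by rw [dif_pos h]⟩,
        h.choose_spec.2⟩
  obtain ⟨f, hf, hfun, hfT⟩ := hM.exists_mem (v := v)
    (R := fun f v => IsFunction f ∧ ∀ x ∈ v 0, ∀ y ∈ H θ, T x y v →
      ∃ z ∈ H θ, ZFSet.pair x z ∈ f ∧ T x z v)
    (.and (.isFunction hX 0) (.ball hX (i := 1) (R := fun x v => ∀ y ∈ H θ,
      T x y (fun n => v (n + 1)) → ∃ z ∈ H θ, ZFSet.pair x z ∈ v 0 ∧ T x z (fun n => v (n + 1)))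
      (.forall_mem (R := fun y v => T (v 0) y (fun n => v (n + 2)) → ∃ z ∈ H θ,
        ZFSet.pair (v 0) z ∈ v 1 ∧ T (v 0) z (fun n => v (n + 2)))
        (.imp (.apply_functions hX hR 1 0 4) (.exists_mem (R := fun z v =>
          ZFSet.pair (v 1) z ∈ v 2 ∧ T (v 1) z (fun n => v (n + 3)))
          (.and (.pair_mem hX 3 2 0) (.apply_functions hX hR 2 0 5)))))))
    hv hex
  obtain ⟨z, hz, hp, w, hw, hwp, hRw⟩ := hfT ξ hξ y hy
    ⟨a, fun i => Hull_subset_of_subset hX hM.subset (ha i), fun i => by rw [hvg]; exact hgp i, hRy⟩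
  have hwa : w = a := funext fun i => (hgfun i).2 _ _ _ (hvg i ▸ hwp i) (hgp i)
  exact ⟨z, mem_Hull.2 ⟨f, hf, hfun, hp⟩, hwa ▸ hRw⟩

/-- A function `f ∈ M` with `f(ξ) ∈ H μ` can be cut down to its pairs in `κ × H μ`. The result is in
`M` by definability, and in `H μ` because it has at most as many elements as `κ`. -/
theorem Elementary.Hull_inter {θ μ : Cardinal.{u}} {M : ZFSet.{u}} (hM : Elementary M (H θ))
    (hθ : θ.IsRegular) (hμ : μ.IsRegular) (hH : H μ ∈ M) {κ ξ : ZFSet.{u}} (hκ : κ ∈ M)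
    (hκμ : κ ∈ H μ) (hξ : ξ ∈ κ) : Hull M ξ ∩ H μ = Hull (M ∩ H μ) ξ := by
  classical
  have hX := isTransitive_H hθ
  ext y
  rw [ZFSet.mem_inter]
  constructor
  · rintro ⟨hy, hyμ⟩
    obtain ⟨f, hf, hfun, hp⟩ := mem_Hull.1 hy
    obtain ⟨g, hg, h1, h2⟩ := hM.exists_mem
      (R := fun g v => (∀ z ∈ g, z ∈ v 0 ∧ ∃ x ∈ v 1, ∃ y ∈ v 2, z = ZFSet.pair x y) ∧
        ∀ z ∈ v 0, (∃ x ∈ v 1, ∃ y ∈ v 2, z = ZFSet.pair x y) → z ∈ g)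
      (.and (.ball hX (i := 0)
          (R := fun z v => z ∈ v 1 ∧ ∃ x ∈ v 2, ∃ y ∈ v 3, z = ZFSet.pair x y)
          (.and (.mem 0 2) (.bex hX (i := 3) (R := fun x v => ∃ y ∈ v 4, v 0 = ZFSet.pair x y)
            (.bex hX (i := 5) (R := fun y v => v 1 = ZFSet.pair (v 0) y) (.eq_pair hX 2 1 0)))))
        (.ball hX (i := 1)
          (R := fun z v => (∃ x ∈ v 2, ∃ y ∈ v 3, z = ZFSet.pair x y) → z ∈ v 0)
          (.imp (.bex hX (i := 3) (R := fun x v => ∃ y ∈ v 4, v 0 = ZFSet.pair x y)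
            (.bex hX (i := 5) (R := fun y v => v 1 = ZFSet.pair (v 0) y) (.eq_pair hX 2 1 0)))
            (.mem 0 1))))
      (push_mem hf (push_mem hκ fun _ => hH))
      ⟨ZFSet.sep (fun z => ∃ x ∈ κ, ∃ y ∈ H μ, z = ZFSet.pair x y) f,
        mem_H_of_subset_mem hθ (hM.subset hf) ZFSet.sep_subset,
        fun z hz => ZFSet.mem_sep.1 hz, fun z hz h => ZFSet.mem_sep.2 ⟨hz, h⟩⟩
    have h1' : ∀ z ∈ g, z ∈ f ∧ ∃ x ∈ κ, ∃ y ∈ H μ, z = ZFSet.pair x y := h1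
    have hgfun : IsFunction g := by
      refine ⟨fun z hz => ?_, fun a b c hb hc => hfun.2 a b c (h1' _ hb).1 (h1' _ hc).1⟩
      obtain ⟨-, x, -, y, -, rfl⟩ := h1' z hz
      exact ⟨x, y, rfl⟩
    have hgμ : g ∈ H μ := by
      refine mem_H_of_subset hμ (fun z hz => ?_) (lt_of_le_of_lt ?_ (card_lt_of_mem_H hμ hκμ))
      · obtain ⟨-, x, hx, y, hy, rfl⟩ := h1' z hz
        exact pair_mem_H hμ (mem_H_of_mem hμ hκμ hx) hy
      · refine card_le_of_surjOn (fun x => if h : ∃ y, ZFSet.pair x y ∈ g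
          then ZFSet.pair x h.choose else ∅) fun z hz => ?_
        obtain ⟨-, x, hx, y, hy, rfl⟩ := h1' z hz
        have h : ∃ y, ZFSet.pair x y ∈ g := ⟨y, hz⟩
        exact ⟨x, hx, by rw [dif_pos h, hgfun.2 _ _ _ h.choose_spec hz]⟩
    exact mem_Hull.2 ⟨g, ZFSet.mem_inter.2 ⟨hg, hgμ⟩, hgfun, h2 _ hp ⟨ξ, hξ, y, hyμ, rfl⟩⟩
  · intro hy
    exact ⟨Hull_mono (fun z hz => (ZFSet.mem_inter.1 hz).1) ξ hy,
      Hull_subset_of_subset (isTransitive_H hμ) (fun z hz => (ZFSet.mem_inter.1 hz).2) hy⟩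

/-! ### The models of a run -/

section Run

variable {K : ZFSet.{u}} {μ : Cardinal.{u}}

theorem IsRun.elementary (hμ : μ.IsRegular) : ∀ {r : List Round.{u}} {M : ZFSet.{u}},
    Elementary M (H μ) → IsRun K M r → Elementary (model M r) (H μ)
  | [], _, hM, _ => hM
  | m :: r, M, hM, hr => IsRun.elementary hμ (M := Hull M m.ξ) (r := r) (hM.elementary_Hull hμ hr.1.2.1 hr.2.1.1) hr.2.2

theorem IsRun.subset_model (hμ : μ.IsRegular) : ∀ {r : List Round.{u}} {M : ZFSet.{u}},
    Elementary M (H μ) → IsRun K M r → M ⊆ model M r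
  | [], _, _, _ => fun _ h => h
  | m :: r, M, hM, hr => fun _ h => IsRun.subset_model hμ (M := Hull M m.ξ) (r := r) (hM.elementary_Hull hμ hr.1.2.1 hr.2.1.1) hr.2.2
      (hM.subset_Hull hμ hr.1.2.1 hr.2.1.1 h)

theorem IsRun.trace_model : ∀ {r : List Round.{u}} {M : ZFSet.{u}},
    IsRun K M r → model M r ∩ om1 = M ∩ om1
  | [], _, _ => rfl
  | m :: r, M, hr => (IsRun.trace_model (M := Hull M m.ξ) (r := r) hr.2.2).trans hr.2.1.2.2

theorem countable_model : ∀ (r : List Round.{u}) {M : ZFSet.{u}},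
    (M : Set ZFSet.{u}).Countable → (model M r : Set ZFSet.{u}).Countable
  | [], _, hM => hM
  | m :: r, _, hM => countable_model r (countable_Hull hM m.ξ)

theorem model_mem {N : ZFSet.{u}} (hμ : μ.IsRegular) (hN : Elementary N (H μ)) :
    ∀ (r : List Round.{u}) {M : ZFSet.{u}}, M ∈ N → (∀ m ∈ r, m.ξ ∈ N) → model M r ∈ N
  | [], _, hM, _ => hM
  | m :: r, _, hM, hr => model_mem hμ hN r (hN.Hull_mem hμ hM (hr m (by simp)))
      fun m' hm' => hr m' (List.mem_cons_of_mem _ hm')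

theorem finite_codeRun (r : List Round.{u}) : (codeRun r : Set ZFSet.{u}).Finite := by
  rw [codeRun, ZFSet.coe_range]
  exact Set.finite_range _

/-- If a model contains a triple, then it includes the last model of its run. -/
theorem model_subset_of_triple_mem {M N s : ZFSet.{u}} {r : List Round.{u}} (hμ : μ.IsRegular)
    (h0 : Cardinal.aleph0 < μ) (hN : Elementary N (H μ)) (hM : (M : Set ZFSet.{u}).Countable)
    (h : triple M r s ∈ N) : model M r ⊆ N := by
  have hr : codeRun r ∈ N := hN.fst_mem hμ (hN.snd_mem hμ h)
  refine hN.subset_of_countable hμ h0 (model_mem hμ hN r (hN.fst_mem hμ h) fun m hm => ?_)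
    (countable_model r hM)
  obtain ⟨i, rfl⟩ := List.get_of_mem hm
  have h1 := hN.subset_of_countable hμ h0 hr (finite_codeRun r).countable
    (ZFSet.mem_range.2 ⟨i, rfl⟩)
  exact hN.snd_mem hμ (hN.snd_mem hμ h1)

/-- The game is played on models inside `H μ`, whereas semigenericity concerns models inside `H θ`;
iterating `Elementary.Hull_inter` transfers a run from the former to the latter. -/
theorem IsRun.model_inter {θ : Cardinal.{u}} (hθ : θ.IsRegular) (hμ : μ.IsRegular)
    (hK : ∀ κ ∈ K, κ ∈ H μ) : ∀ {r : List Round.{u}} {M : ZFSet.{u}}, Elementary M (H θ) →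
      H μ ∈ M → IsRun K (M ∩ H μ) r → Elementary (model M r) (H θ) ∧ M ⊆ model M r ∧
        model M r ∩ H μ = model (M ∩ H μ) r
  | [], _, hM, _, _ => ⟨hM, fun _ h => h, rfl⟩
  | m :: r, M, hM, hH, hr => by
    have hκ : m.κ ∈ M := (ZFSet.mem_inter.1 hr.1.2.1).1
    have hξ := hr.2.1.1
    have h1 := hM.Hull_inter hθ hμ hH hκ (hK _ hr.1.1) hξ
    have h2 := hM.subset_Hull hθ hκ hξ
    have h3 : IsRun K (Hull M m.ξ ∩ H μ) r := by
      rw [h1]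
      exact hr.2.2
    obtain ⟨h4, h5, h6⟩ := IsRun.model_inter hθ hμ hK (hM.elementary_Hull hθ hκ hξ) (h2 hH) h3
    refine ⟨h4, fun x hx => h5 (h2 hx), h6.trans ?_⟩
    rw [h1]
    rfl

end Run

/-! ### Closure under countably many finitary operations -/

/-- The closure of `A` under the set-valued operation `F` on finite lists. -/
inductive Closure (F : List ZFSet.{u} → Set ZFSet.{u}) (A : Set ZFSet.{u}) : ZFSet.{u} → Prop
  | base {x : ZFSet.{u}} : x ∈ A → Closure F A x
  | app {l : List ZFSet.{u}} {y : ZFSet.{u}} : (∀ x ∈ l, Closure F A x) → y ∈ F l → Closure F A y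

/-- The set `A` is closed under the operation `F`. -/
def ClosedUnder (F : List ZFSet.{u} → Set ZFSet.{u}) (A : Set ZFSet.{u}) : Prop :=
  ∀ l : List ZFSet.{u}, (∀ x ∈ l, x ∈ A) → F l ⊆ A

theorem closedUnder_closure (F : List ZFSet.{u} → Set ZFSet.{u}) (A : Set ZFSet.{u}) :
    ClosedUnder F {x | Closure F A x} :=
  fun _ hl _ hy => .app hl hy

theorem Closure.mem_of_closedUnder {F : List ZFSet.{u} → Set ZFSet.{u}} {A B : Set ZFSet.{u}}
    (hAB : A ⊆ B) (hB : ClosedUnder F B) {x : ZFSet.{u}} (hx : Closure F A x) : x ∈ B := by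
  induction hx with
  | base h => exact hAB h
  | app _ hy ih => exact hB _ ih hy

theorem countable_lists {α : Type*} {A : Set α} (hA : A.Countable) :
    {l : List α | ∀ x ∈ l, x ∈ A}.Countable := by
  have := hA.to_subtype
  refine (Set.countable_range fun l : List A => l.map Subtype.val).mono fun l hl => ?_
  exact ⟨l.attach.map fun x => ⟨x.1, hl x.1 x.2⟩, by simp⟩

theorem countable_closure {F : List ZFSet.{u} → Set ZFSet.{u}} (hF : ∀ l, (F l).Countable)
    {A : Set ZFSet.{u}} (hA : A.Countable) : {x | Closure F A x}.Countable := by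
  let L : ℕ → Set ZFSet.{u} := fun n =>
    Nat.rec A (fun _ B => B ∪ ⋃ l ∈ {l : List ZFSet.{u} | ∀ x ∈ l, x ∈ B}, F l) n
  have hL : ∀ n, L (n + 1) = L n ∪ ⋃ l ∈ {l : List ZFSet.{u} | ∀ x ∈ l, x ∈ L n}, F l :=
    fun _ => rfl
  have hmono : Monotone L := monotone_nat_of_le_succ fun n => by
    rw [hL]
    exact Set.subset_union_left
  have hc : ∀ n, (L n).Countable := by
    intro n
    induction n with
    | zero => exact hA
    | succ n ih =>
      rw [hL]
      exact ih.union ((countable_lists ih).biUnion fun l _ => hF l)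
  refine (Set.countable_iUnion hc).mono fun x hx => ?_
  induction hx with
  | base h => exact Set.mem_iUnion.2 ⟨0, h⟩
  | @app l y hl' hy ih =>
    have hl : ∃ n, ∀ x ∈ l, x ∈ L n := by
      clear hy hl'
      induction l with
      | nil => exact ⟨0, by simp⟩
      | cons a l ihl =>
        obtain ⟨n, hn⟩ := ihl fun x hx => ih x (List.mem_cons_of_mem _ hx)
        obtain ⟨m, hm⟩ := Set.mem_iUnion.1 (ih a (by simp))
        refine ⟨max n m, fun x hx => ?_⟩
        rcases List.mem_cons.1 hx with rfl | hx
        exacts [hmono (le_max_right _ _) hm, hmono (le_max_left _ _) (hn x hx)]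
    obtain ⟨n, hn⟩ := hl
    refine Set.mem_iUnion.2 ⟨n + 1, ?_⟩
    rw [hL]
    exact Or.inr (Set.mem_biUnion (x := l) hn hy)

/-- The closure of the von Neumann ordinal `δ` under the operation `F`. -/
def closureOrd (F : List ZFSet.{u} → Set ZFSet.{u}) (δ : Ordinal.{u}) : Set ZFSet.{u} :=
  {x | Closure F (δ.toZFSet : Set ZFSet.{u}) x}

theorem closureOrd_mono (F : List ZFSet.{u} → Set ZFSet.{u}) {γ δ : Ordinal.{u}} (h : γ ≤ δ) :
    closureOrd F γ ⊆ closureOrd F δ :=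
  fun _ hx => hx.mem_of_closedUnder
    (fun _ hz => .base (Ordinal.toZFSet_subset_toZFSet_iff.2 h hz)) (closedUnder_closure _ _)

/-- Each element of the closure is generated from finitely many ordinals below `δ`. -/
theorem exists_closureOrd_of_isLUB {F : List ZFSet.{u} → Set ZFSet.{u}} {D : Set Ordinal.{u}}
    (hD : D.Nonempty) {δ : Ordinal.{u}} (hδ : IsLUB D δ) {x : ZFSet.{u}}
    (hx : x ∈ closureOrd F δ) : ∃ γ ∈ D, x ∈ closureOrd F γ := by
  induction hx with
  | base h =>
    obtain ⟨a, ha, rfl⟩ := Ordinal.mem_toZFSet_iff.1 h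
    obtain ⟨γ, hγ, hlt⟩ := (lt_isLUB_iff hδ).1 ha
    exact ⟨γ, hγ, .base (Ordinal.toZFSet_mem_toZFSet_iff.2 hlt)⟩
  | @app l y hl' hy ih =>
    suffices hl : ∃ γ ∈ D, ∀ x ∈ l, x ∈ closureOrd F γ by
      obtain ⟨γ, hγ, h⟩ := hl
      exact ⟨γ, hγ, .app h hy⟩
    clear hy hl'
    induction l with
    | nil =>
      obtain ⟨γ, hγ⟩ := hD
      exact ⟨γ, hγ, by simp⟩
    | cons a l ihl =>
      obtain ⟨γ, hγ, h⟩ := ihl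
        fun x hx => ih x (List.mem_cons_of_mem _ hx)
      obtain ⟨γ', hγ', h'⟩ := ih a (by simp)
      refine ⟨max γ γ', ?_, fun x hx => ?_⟩
      · rcases max_choice γ γ' with h | h <;> rw [h] <;> assumption
      · rcases List.mem_cons.1 hx with rfl | hx
        exacts [closureOrd_mono F (le_max_right _ _) h', closureOrd_mono F (le_max_left _ _) (h x hx)]

theorem countable_closureOrd {F : List ZFSet.{u} → Set ZFSet.{u}} (hF : ∀ l, (F l).Countable)
    {δ : Ordinal.{u}} (hδ : δ < Ordinal.omega 1) : (closureOrd F δ).Countable :=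
  countable_closure hF (countable_of_mem_om1 (Ordinal.toZFSet_mem_toZFSet_iff.2 hδ))

theorem exists_bound_closureOrd {F : List ZFSet.{u} → Set ZFSet.{u}} (hF : ∀ l, (F l).Countable)
    (δ : Set.Iio (Ordinal.omega.{u} 1)) : ∃ γ : Set.Iio (Ordinal.omega.{u} 1), δ ≤ γ ∧
      ∀ x ∈ om1, x ∈ closureOrd F δ.1 → x ∈ γ.1.toZFSet := by
  have hlim : Order.IsSuccLimit (Ordinal.omega.{u} 1) := Cardinal.isSuccLimit_omega 1
  have hc : (closureOrd F δ.1 ∩ om1).Countable :=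
    (countable_closureOrd hF δ.2).mono Set.inter_subset_left
  have := hc.to_subtype
  let f : (closureOrd F δ.1 ∩ om1 : Set ZFSet.{u}) → Ordinal.{u} := fun x => Order.succ x.1.rank
  have hf : ∀ x, f x < Ordinal.omega 1 := by
    rintro ⟨x, -, hx⟩
    refine hlim.succ_lt ?_
    obtain ⟨a, ha, rfl⟩ := Ordinal.mem_toZFSet_iff.1 (show x ∈ om1 from hx)
    rwa [Ordinal.rank_toZFSet]
  refine ⟨⟨max δ.1 (⨆ x, f x), max_lt δ.2 (Ordinal.iSup_lt_omega_one hf)⟩,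
    Subtype.coe_le_coe.1 (le_max_left _ _), fun x hx hxc => ?_⟩
  have h1 : x.rank < ⨆ x, f x := lt_of_lt_of_le (Order.lt_succ _)
    (Ordinal.le_iSup f ⟨x, hxc, hx⟩)
  rw [← (isOrdinal_om1.mem hx).toZFSet_rank_eq, Ordinal.toZFSet_mem_toZFSet_iff]
  exact h1.trans_le (le_max_right _ _)

/-- Closedness follows from finitary generation, unboundedness from iterating
`exists_bound_closureOrd` and taking the supremum of `ω` steps. -/
theorem isClub_closureOrd {F : List ZFSet.{u} → Set ZFSet.{u}} (hF : ∀ l, (F l).Countable) :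
    IsClub {δ : Set.Iio (Ordinal.omega.{u} 1) |
      ∀ x ∈ om1, x ∈ closureOrd F δ.1 → x ∈ δ.1.toZFSet} := by
  have key : ∀ D : Set (Set.Iio (Ordinal.omega.{u} 1)), D.Nonempty → ∀ δ, IsLUB D δ →
      ∀ x ∈ closureOrd F δ.1, ∃ γ ∈ D, x ∈ closureOrd F γ.1 := by
    intro D hD δ hδ x hx
    have h1 : IsLUB (Subtype.val '' D) δ.1 := by
      refine ⟨?_, fun b hb => ?_⟩
      · rintro _ ⟨γ, hγ, rfl⟩
        exact hδ.1 hγ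
      · by_contra hlt
        have hb' : b < δ.1 := not_le.1 hlt
        exact hlt (hδ.2 (show (⟨b, hb'.trans δ.2⟩ : Set.Iio (Ordinal.omega.{u} 1)) ∈ upperBounds D
          from fun γ hγ => hb (Set.mem_image_of_mem _ hγ)))
    obtain ⟨_, ⟨γ, hγ, rfl⟩, h⟩ := exists_closureOrd_of_isLUB (hD.image _) h1 hx
    exact ⟨γ, hγ, h⟩
  refine ⟨fun D hDs hD _ δ hδ x hx hxc => ?_, fun a => ?_⟩
  · obtain ⟨γ, hγ, h⟩ := key D hD δ hδ x hxc
    exact Ordinal.toZFSet_subset_toZFSet_iff.2 (hδ.1 hγ) (hDs hγ x hx h)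
  · choose g hg1 hg2 using exists_bound_closureOrd hF
    let b : ℕ → Set.Iio (Ordinal.omega.{u} 1) := fun n => g^[n] a
    have hb : ∀ n, b (n + 1) = g (b n) := fun n => Function.iterate_succ_apply' g n a
    have hlt : ⨆ n, (b n).1 < Ordinal.omega 1 := Ordinal.iSup_lt_omega_one fun n => (b n).2
    have hlub : IsLUB (Set.range b) ⟨⨆ n, (b n).1, hlt⟩ := by
      refine ⟨?_, fun c hc => ?_⟩
      · rintro _ ⟨n, rfl⟩
        exact Ordinal.le_iSup (fun n => (b n).1) n
      · exact Ordinal.iSup_le fun n => hc ⟨n, rfl⟩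
    refine ⟨_, fun x hx hxc => ?_, hlub.1 ⟨0, rfl⟩⟩
    obtain ⟨_, ⟨n, rfl⟩, h⟩ := key _ (Set.range_nonempty b) _ hlub x hxc
    refine Ordinal.toZFSet_subset_toZFSet_iff.2 (hlub.1 ⟨n + 1, rfl⟩) ?_
    rw [hb]
    exact hg2 _ x hx h

theorem mem_closureOrd_iff {F : List ZFSet.{u} → Set ZFSet.{u}} {δ : Ordinal.{u}}
    (h : ∀ x ∈ om1, x ∈ closureOrd F δ → x ∈ δ.toZFSet) {x : ZFSet.{u}} (hx : x ∈ om1) :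
    x ∈ closureOrd F δ ↔ x ∈ δ.toZFSet :=
  ⟨h x hx, fun h => .base h⟩

/-- Every club of `[X]^ω` contains all countable sets that are closed under a suitable
operation. -/
theorem IsClubIn.exists_operation {X c₀ : ZFSet.{u}} {C : Set ZFSet.{u}} (hC : IsClubIn X C)
    (hc₀ : c₀ ∈ C) : ∃ F : List ZFSet.{u} → Set ZFSet.{u}, (∀ l, (F l).Countable) ∧
      ∀ A : Set ZFSet.{u}, ClosedUnder F A → A.Countable → ZFSet.sep (· ∈ A) X ∈ C := by
  classical
  have hstep : ∀ (x : ZFSet.{u}) (c : C), ∃ d : C, c.1 ⊆ d.1 ∧ (x ∈ X → x ∈ d.1) := by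
    intro x c
    by_cases hx : x ∈ X
    · obtain ⟨h1, h2, h3⟩ := hC.subset c.2
      have h4 : insert x c.1 ∈ ctblSubsets X := by
        refine ⟨fun z hz => ?_, ?_, ?_⟩
        · rcases ZFSet.mem_insert_iff.1 hz with rfl | hz
          exacts [hx, h1 hz]
        · rw [ZFSet.coe_insert]
          exact h2.insert x
        · rw [ZFSet.coe_insert]
          exact h3.mono (Set.subset_insert _ _)
      obtain ⟨d, hd, hcd⟩ := hC.unbounded _ h4
      exact ⟨⟨d, hd⟩, fun z hz => hcd (ZFSet.mem_insert_of_mem _ hz),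
        fun _ => hcd (ZFSet.mem_insert _ _)⟩
    · exact ⟨c, fun _ h => h, fun h => absurd h hx⟩
  choose e he1 he2 using hstep
  -- Prepending an element of `X` to the list enlarges `g` to a member of `C` containing it. Along
  -- an enumeration of `A ∩ X` the sets `g (L n)` thus form an increasing chain in `C` with union `A
  -- ∩ X`.
  let g : List ZFSet.{u} → C := fun l => l.foldr e ⟨c₀, hc₀⟩
  have hg : ∀ x l, g (x :: l) = e x (g l) := fun _ _ => rfl
  refine ⟨fun l => ((g l).1 : Set ZFSet.{u}), fun l => (hC.subset (g l).2).2.1,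
    fun A hA hAc => ?_⟩
  have hsub : ∀ l : List ZFSet.{u}, (∀ x ∈ l, x ∈ A) → (g l).1 ⊆ ZFSet.sep (· ∈ A) X :=
    fun l hl x hx => ZFSet.mem_sep.2 ⟨(hC.subset (g l).2).1 hx, hA l hl hx⟩
  have hMc : (ZFSet.sep (· ∈ A) X : Set ZFSet.{u}).Countable :=
    hAc.mono fun x hx => (ZFSet.mem_sep.1 hx).2
  have hMne : (ZFSet.sep (· ∈ A) X : Set ZFSet.{u}).Nonempty :=
    (hC.subset hc₀).2.2.nonempty.mono (hsub [] (by simp))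
  obtain ⟨f, hf⟩ := hMc.exists_eq_range hMne
  have hfM : ∀ n, f n ∈ ZFSet.sep (· ∈ A) X := fun n => by
    have : f n ∈ (ZFSet.sep (· ∈ A) X : Set ZFSet.{u}) := hf ▸ ⟨n, rfl⟩
    exact this
  let L : ℕ → List ZFSet.{u} := fun n => Nat.rec [] (fun k l => f k :: l) n
  have hL : ∀ n, L (n + 1) = f n :: L n := fun _ => rfl
  have hLA : ∀ n, ∀ x ∈ L n, x ∈ A := by
    intro n
    induction n with
    | zero => simp [L]
    | succ n ih =>
      intro x hx
      rcases List.mem_cons.1 (hL n ▸ hx) with rfl | hx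
      exacts [(ZFSet.mem_sep.1 (hfM n)).2, ih x hx]
  have hU : ZFSet.iUnion (fun n => (g (L n)).1) = ZFSet.sep (· ∈ A) X := by
    ext x
    rw [ZFSet.mem_iUnion]
    constructor
    · rintro ⟨n, hn⟩
      exact hsub _ (hLA n) hn
    · intro hx
      have : x ∈ (ZFSet.sep (· ∈ A) X : Set ZFSet.{u}) := hx
      rw [hf] at this
      obtain ⟨n, rfl⟩ := this
      refine ⟨n + 1, ?_⟩
      rw [hL, hg]
      exact he2 _ _ (ZFSet.mem_sep.1 (hfM n)).1
  rw [← hU]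
  refine hC.closed _ (fun n => (g (L n)).2) fun n => ?_
  rw [hL, hg]
  exact he1 _ _

/-! ### The game -/

theorem model_append (M : ZFSet.{u}) (r₁ r₂ : List Round.{u}) :
    model M (r₁ ++ r₂) = model (model M r₁) r₂ :=
  List.foldl_append

theorem isRun_append {K : ZFSet.{u}} : ∀ {r₁ r₂ : List Round.{u}} {M : ZFSet.{u}},
    IsRun K M (r₁ ++ r₂) ↔ IsRun K M r₁ ∧ IsRun K (model M r₁) r₂
  | [], _, _ => by simp [IsRun, model]
  | m :: r₁, r₂, M => by
    have ih := isRun_append (K := K) (r₁ := r₁) (r₂ := r₂) (M := Hull M m.ξ)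
    have h : model M (m :: r₁) = model (Hull M m.ξ) r₁ := rfl
    simp only [List.cons_append, IsRun, h, ih, and_assoc]

theorem Follows.of_append {s : ZFSet.{u}} {r₁ r₂ : List Round.{u}} (h : Follows s (r₁ ++ r₂)) :
    Follows s r₁ := by
  rintro r m r' rfl
  exact h r m (r' ++ r₂) (by simp)

theorem position_inj {r r' : List Round.{u}} {κ ν κ' ν' : ZFSet.{u}} :
    position r κ ν = position r' κ' ν' ↔ r = r' ∧ κ = κ' ∧ ν = ν' := by
  simp only [position, ZFSet.pair_inj, codeRun_injective.eq_iff]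

/-- Strategy trees for the first player. -/
inductive WinTree : Type (u + 1)
  | leaf : WinTree
  | node (κ ν : ZFSet.{u}) (next : ZFSet.{u} → WinTree) : WinTree

/-- Following the strategy tree, the first player wins when the current model is `N`. -/
def WinTree.Wins (K : ZFSet.{u}) : WinTree.{u} → ZFSet.{u} → Prop
  | leaf, _ => False
  | node κ ν next, N => LegalPI K N κ ν ∧
      ∀ ξ, LegalPII N κ ν ξ → (next ξ).Wins K (Hull N ξ)

/-- Otherwise the winning trees after the legal answers could be joined into one for `N` with first
move `(κ, ν)`. -/
theorem exists_answer {K N κ ν : ZFSet.{u}} (hN : ¬ ∃ T : WinTree.{u}, T.Wins K N)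
    (h : LegalPI K N κ ν) :
    ∃ ξ, LegalPII N κ ν ξ ∧ ¬ ∃ T : WinTree.{u}, T.Wins K (Hull N ξ) := by
  classical
  by_contra! hcon
  refine hN ⟨.node κ ν fun ξ => if hξ : LegalPII N κ ν ξ then (hcon ξ hξ).choose else .leaf,
    h, fun ξ hξ => ?_⟩
  beta_reduce
  rw [dif_pos hξ]
  exact (hcon ξ hξ).choose_spec

open Classical in
/-- The answer of the second player who avoids the positions that are won by the first player. -/
def answer (K N κ ν : ZFSet.{u}) : ZFSet.{u} :=
  if h : ∃ ξ, LegalPII N κ ν ξ ∧ ¬ ∃ T : WinTree.{u}, T.Wins K (Hull N ξ) then h.choose else ν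

/-- A strategy has to give an element of `κ` also at positions that are already lost; there the
default `ν` serves. -/
theorem answer_mem {K N κ ν : ZFSet.{u}} (h : ν ∈ κ) : answer K N κ ν ∈ κ := by
  rw [answer]
  split_ifs with h1
  exacts [h1.choose_spec.1.1, h]

/-- If the first player has no winning strategy, then the second player has one. -/
theorem exists_isWinningStrategy {K M : ZFSet.{u}} {μ : Cardinal.{u}} (hμ : μ.IsRegular)
    (hlam : MuchLess (ZFSet.sUnion K) μ) (hM : ¬ ∃ T : WinTree.{u}, T.Wins K M) :
    ∃ s, IsWinningStrategy K M s := by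
  have ho : Order.IsSuccLimit μ.ord := Cardinal.isSuccLimit_ord hμ.aleph0_le
  have ht : ∀ {a b : ZFSet.{u}}, a ∈ b → b ∈ ZFSet.vonNeumann μ.ord →
      a ∈ ZFSet.vonNeumann μ.ord := fun h1 h2 => ZFSet.isTransitive_vonNeumann _ _ h2 h1
  let s := ZFSet.sep (fun z => ∃ r κ ν, IsRun K M r ∧ LegalPI K (model M r) κ ν ∧
    z = ZFSet.pair (position r κ ν) (answer K (model M r) κ ν)) (ZFSet.vonNeumann μ.ord)
  have hs : ∀ r κ ν ξ, ZFSet.pair (position r κ ν) ξ ∈ s ↔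
      IsRun K M r ∧ LegalPI K (model M r) κ ν ∧ ξ = answer K (model M r) κ ν := by
    intro r κ ν ξ
    rw [ZFSet.mem_sep]
    constructor
    · rintro ⟨-, r', κ', ν', hr, hl, h⟩
      obtain ⟨h1, rfl⟩ := ZFSet.pair_inj.1 h
      obtain ⟨rfl, rfl, rfl⟩ := position_inj.1 h1
      exact ⟨hr, hl, rfl⟩
    · rintro ⟨hr, hl, rfl⟩
      refine ⟨?_, r, κ, ν, hr, hl, rfl⟩
      have hκ := mem_vonNeumann_of_mem_K hμ hlam hl.1
      exact pair_mem_vonNeumann ho (pair_mem_vonNeumann ho (codeRun_mem hμ hlam hr)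
        (pair_mem_vonNeumann ho hκ (ht hl.2.2 hκ))) (ht (answer_mem hl.2.2) hκ)
  have hs' : ∀ z ∈ s, ∃ r κ ν ξ, z = ZFSet.pair (position r κ ν) ξ := by
    intro z hz
    obtain ⟨-, r, κ, ν, -, -, h⟩ := ZFSet.mem_sep.1 hz
    exact ⟨r, κ, ν, _, h⟩
  refine ⟨s, ⟨⟨fun z hz => ?_, fun a b c hb hc => ?_⟩, fun x => ⟨?_, ?_⟩, ?_⟩, ?_⟩
  · obtain ⟨r, κ, ν, ξ, rfl⟩ := hs' z hz
    exact ⟨_, _, rfl⟩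
  · obtain ⟨r, κ, ν, ξ, h⟩ := hs' _ hb
    obtain ⟨rfl, -⟩ := ZFSet.pair_inj.1 h
    rw [((hs _ _ _ _).1 hb).2.2, ((hs _ _ _ _).1 hc).2.2]
  · rintro ⟨y, hy⟩
    obtain ⟨r, κ, ν, ξ, h⟩ := hs' _ hy
    obtain ⟨rfl, -⟩ := ZFSet.pair_inj.1 h
    have h1 := (hs _ _ _ _).1 hy
    exact ⟨r, κ, ν, h1.1, h1.2.1, rfl⟩
  · rintro ⟨r, κ, ν, hr, hl, rfl⟩
    exact ⟨_, (hs _ _ _ _).2 ⟨hr, hl, rfl⟩⟩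
  · intro r κ ν ξ h
    obtain ⟨-, hl, rfl⟩ := (hs _ _ _ _).1 h
    exact answer_mem hl.2.2
  -- The invariant of the strategy: no position reached by following it is won by the first player.
  · have key : ∀ r, IsRun K M r → Follows s r → ¬ ∃ T : WinTree.{u}, T.Wins K (model M r) := by
      intro r
      induction r using List.reverseRecOn with
      | nil => exact fun _ _ => hM
      | append_singleton r m ih =>
        intro hr hf
        obtain ⟨hr1, hr2⟩ := isRun_append.1 hr
        have h1 := exists_answer (ih hr1 hf.of_append) hr2.1
        have h2 := ((hs _ _ _ _).1 (hf r m [] rfl)).2.2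
        rw [answer, dif_pos h1] at h2
        rw [model_append]
        change ¬ ∃ T : WinTree.{u}, T.Wins K (Hull (model M r) m.ξ)
        rw [h2]
        exact h1.choose_spec.2
    intro r κ ν ξ hr hf hl h
    have h1 := exists_answer (key r hr hf) hl
    have h2 := ((hs _ _ _ _).1 h).2.2
    rw [answer, dif_pos h1] at h2
    rw [h2]
    exact h1.choose_spec.1

/-! ### Models for which the second player wins -/

/-- The first player's move according to a strategy tree. -/
def WinTree.move : WinTree.{u} → ZFSet.{u} × ZFSet.{u}
  | leaf => (∅, ∅)
  | node κ ν _ => (κ, ν)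

/-- The rest of a strategy tree after an answer of the second player. -/
def WinTree.rest : WinTree.{u} → ZFSet.{u} → WinTree.{u}
  | leaf, _ => leaf
  | node _ _ next, ξ => next ξ

open Classical in
/-- An ordinal below `κ` that is a legal answer for all those of the given trees that start
with `κ`. -/
def response (κ : ZFSet.{u}) (T : Set.Iio (Ordinal.omega.{u} 1) → WinTree.{u}) : ZFSet.{u} :=
  Ordinal.toZFSet (⨆ δ, if (T δ).move.1 = κ ∧ (T δ).move.2 ∈ κ then (T δ).move.2.rank else 0)

/-- A supremum of `ω₁` many ordinals below a regular cardinal greater than `ω₁`; this is the reason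
for excluding `ω₁` from `K`. -/
theorem response_mem {κ : ZFSet.{u}} (hκ : IsUncountableRegular κ) (h1 : κ ≠ om1)
    (T : Set.Iio (Ordinal.omega.{u} 1) → WinTree.{u}) : response κ T ∈ κ := by
  obtain ⟨c, hc0, hc, rfl⟩ := hκ
  have hc1 : Cardinal.aleph 1 < c := by
    refine lt_of_le_of_ne ?_ ?_
    · rw [← zero_add 1, ← Cardinal.succ_aleph, Cardinal.aleph_zero]
      exact Order.succ_le_of_lt hc0
    · rintro rfl
      exact h1 (by rw [om1, Cardinal.ord_aleph])
  rw [response, Ordinal.toZFSet_mem_toZFSet_iff]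
  refine Ordinal.lift_iSup_lt_of_lt_cof ?_ fun δ => ?_
  · rw [← Ordinal.lift_cof, hc.cof_ord, Cardinal.mk_Iio_ordinal]
    simpa using hc1
  · split_ifs with h
    · obtain ⟨a, ha, h2⟩ := Ordinal.mem_toZFSet_iff.1 h.2
      rw [← h2, Ordinal.rank_toZFSet]
      exact ha
    · exact Cardinal.lt_ord.2 (by simpa using hc.pos)

theorem response_notMem {κ : ZFSet.{u}} {T : Set.Iio (Ordinal.omega.{u} 1) → WinTree.{u}}
    {δ : Set.Iio (Ordinal.omega.{u} 1)} (h1 : (T δ).move.1 = κ) (h2 : (T δ).move.2 ∈ κ) :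
    response κ T ∉ (T δ).move.2 := by
  intro h
  have h3 := ZFSet.rank_lt_of_mem h
  rw [response, Ordinal.rank_toZFSet] at h3
  refine absurd h3 (not_lt.2 ?_)
  refine le_trans ?_ (Ordinal.le_iSup _ δ)
  rw [if_pos ⟨h1, h2⟩]

/-- The strategy trees that remain after the first player has chosen the cardinals in the given
list (last choice first) and the second player has answered with `response`. -/
def remaining (T : Set.Iio (Ordinal.omega.{u} 1) → WinTree.{u}) :
    List ZFSet.{u} → Set.Iio (Ordinal.omega.{u} 1) → WinTree.{u}
  | [], δ => T δ
  | κ :: l, δ => (remaining T l δ).rest (response κ (remaining T l))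

/-- The values of functions, as an operation on lists of length two. -/
def applyOp : List ZFSet.{u} → Set ZFSet.{u}
  | [f, x] => {y | IsFunction f ∧ ZFSet.pair x y ∈ f}
  | _ => ∅

theorem countable_applyOp (l : List ZFSet.{u}) : (applyOp l).Countable := by
  unfold applyOp
  split
  · exact Set.Subsingleton.countable fun y hy z hz => hy.1.2 _ _ _ hy.2 hz.2
  · exact Set.countable_empty

theorem Hull_subset_of_applyOp {B : Set ZFSet.{u}} (hB : ∀ l : List ZFSet.{u},
    (∀ x ∈ l, x ∈ B) → applyOp l ⊆ B) {N x : ZFSet.{u}} (hN : ∀ y ∈ N, y ∈ B) (hx : x ∈ B) :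
    ∀ y ∈ Hull N x, y ∈ B := by
  intro y hy
  obtain ⟨f, hf, hfun, hp⟩ := mem_Hull.1 hy
  exact hB [f, x] (by simp [hN f hf, hx]) ⟨hfun, hp⟩

/-- There are projective stationary many models for which the second player wins the game. -/
theorem exists_winning_model {K : ZFSet.{u}} (hK : ∀ κ ∈ K, IsUncountableRegular κ)
    (hω₁ : om1 ∉ K) {μ : Cardinal.{u}} (hμ : μ.IsRegular)
    (hlam : MuchLess (ZFSet.sUnion K) μ) (h0 : Cardinal.aleph0 < μ)
    {F : List ZFSet.{u} → Set ZFSet.{u}} (hF : ∀ l, (F l).Countable)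
    {S : Set (Set.Iio (Ordinal.omega.{u} 1))} (hS : IsStationary S) :
    ∃ A : Set ZFSet.{u}, A.Countable ∧ ClosedUnder F A ∧
      (∃ δ ∈ S, ∀ x ∈ om1, x ∈ A ↔ x ∈ δ.1.toZFSet) ∧
      Elementary (ZFSet.sep (· ∈ A) (H μ)) (H μ) ∧ K ∈ A ∧
      ∃ s, IsWinningStrategy K (ZFSet.sep (· ∈ A) (H μ)) s := by
  classical
  let F₁ : List ZFSet.{u} → Set ZFSet.{u} := fun l =>
    F l ∪ (skolem (H μ) l ∪ (applyOp l ∪ {K}))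
  have hF₁ : ∀ l, (F₁ l).Countable := fun l => (hF l).union ((skolem_countable _ l).union
    ((countable_applyOp l).union (Set.countable_singleton K)))
  let N : Ordinal.{u} → ZFSet.{u} := fun δ => ZFSet.sep (· ∈ closureOrd F₁ δ) (H μ)
  by_contra hcon
  have hcl₁ : ∀ B, ClosedUnder F₁ B → ClosedUnder F B ∧ Elementary (ZFSet.sep (· ∈ B) (H μ)) (H μ) ∧
      (∀ l : List ZFSet.{u}, (∀ x ∈ l, x ∈ B) → applyOp l ⊆ B) ∧ K ∈ B := by
    intro B hB
    refine ⟨fun l hl x hx => hB l hl (Or.inl hx), elementary_of_skolem fun l hl x hx =>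
      hB l hl (Or.inr (Or.inl hx)), fun l hl x hx => hB l hl (Or.inr (Or.inr (Or.inl hx))),
      hB [] (by simp) (Or.inr (Or.inr (Or.inr rfl)))⟩
  have hT : ∀ δ : Set.Iio (Ordinal.omega.{u} 1), ∃ T : WinTree.{u}, δ ∈ S →
      (∀ x ∈ om1, x ∈ closureOrd F₁ δ.1 → x ∈ δ.1.toZFSet) → T.Wins K (N δ.1) := by
    intro δ
    by_contra! hno
    -- The leaf is an arbitrary tree, used only to extract the two premises.
    obtain ⟨hδS, hδ, -⟩ := hno .leaf
    obtain ⟨h1, h2, -, h3⟩ := hcl₁ _ (closedUnder_closure F₁ _)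
    exact hcon ⟨closureOrd F₁ δ.1, countable_closureOrd hF₁ δ.2, h1,
      ⟨δ, hδS, fun x hx => mem_closureOrd_iff hδ hx⟩, h2, h3,
      exists_isWinningStrategy hμ hlam fun ⟨T, hT⟩ => (hno T).2.2 hT⟩
  choose T hT using hT
  -- The answers become operations on finite lists of cardinals. This is possible because they do
  -- not mention `δ`.
  let F₂ : List ZFSet.{u} → Set ZFSet.{u} := fun l => F₁ l ∪
    match l with
    | [] => ∅
    | κ :: l => {response κ (remaining T l)}
  have hF₂ : ∀ l, (F₂ l).Countable := by
    intro l
    refine (hF₁ l).union ?_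
    cases l
    exacts [Set.countable_empty, Set.countable_singleton _]
  -- The closure of this `δ` under `F₂` has trace `δ`. It includes the closure under `F₁`, which
  -- therefore also has trace `δ`, so that `T δ` really wins for `N δ`.
  obtain ⟨δ, hδS, hδ⟩ := hS (isClub_closureOrd hF₂)
  have hB₂ : ClosedUnder F₂ (closureOrd F₂ δ.1) := closedUnder_closure _ _
  have hB₁ : ClosedUnder F₁ (closureOrd F₂ δ.1) := fun l hl x hx => hB₂ l hl (Or.inl hx)
  have h12 : closureOrd F₁ δ.1 ⊆ closureOrd F₂ δ.1 := fun x hx =>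
    hx.mem_of_closedUnder (fun _ h => .base h) hB₁
  obtain ⟨-, -, happ, -⟩ := hcl₁ _ hB₁
  -- Induction on the tree that remains of `T δ` after the cardinals in `l`. The current model stays
  -- inside the `F₂`-closure of `δ`, so its trace stays `δ`.
  have key : ∀ (t : WinTree.{u}) (l : List ZFSet.{u}) (M : ZFSet.{u}), t.Wins K M →
      remaining T l δ = t → (∀ x ∈ l, x ∈ closureOrd F₂ δ.1) →
      (∀ x ∈ M, x ∈ closureOrd F₂ δ.1) → Elementary M (H μ) → M ∩ om1 = δ.1.toZFSet → False := by
    intro t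
    induction t with
    | leaf => exact fun _ _ h => h.elim
    | node κ ν next ih =>
      intro l M hw hrem hl hM hMe htr
      obtain ⟨⟨hκK, hκM, hνκ⟩, hnext⟩ := hw
      let ξ := response κ (remaining T l)
      have hξB : ξ ∈ closureOrd F₂ δ.1 := by
        refine hB₂ (κ :: l) (fun x hx => ?_) (Or.inr rfl)
        rcases List.mem_cons.1 hx with rfl | hx
        exacts [hM _ hκM, hl x hx]
      have hξκ : ξ ∈ κ := response_mem (hK κ hκK) (fun h => hω₁ (h ▸ hκK)) _
      have hξν : ξ ∉ ν := by
        have h1 := response_notMem (κ := κ) (T := remaining T l) (δ := δ)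
        rw [hrem] at h1
        exact h1 rfl hνκ
      have hHB : ∀ y ∈ Hull M ξ, y ∈ closureOrd F₂ δ.1 := Hull_subset_of_applyOp happ hM hξB
      have hHtr : Hull M ξ ∩ om1 = M ∩ om1 := by
        ext x
        rw [ZFSet.mem_inter, ZFSet.mem_inter]
        refine ⟨fun hx => ?_, fun hx => ⟨hMe.subset_Hull hμ hκM hξκ hx.1, hx.2⟩⟩
        have h1 := hδ x hx.2 (hHB x hx.1)
        rw [← htr] at h1
        exact ZFSet.mem_inter.1 h1
      refine ih ξ (κ :: l) (Hull M ξ) (hnext ξ ⟨hξκ, hξν, hHtr⟩) ?_ (fun x hx => ?_) hHB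
        (hMe.elementary_Hull hμ hκM hξκ) (hHtr.trans htr)
      · rw [remaining, hrem]
        rfl
      · rcases List.mem_cons.1 hx with rfl | hx
        exacts [hM _ hκM, hl x hx]
  refine key (T δ) [] (N δ.1) (hT δ hδS fun x hx h => hδ x hx (h12 h)) rfl (by simp)
    (fun x hx => h12 (ZFSet.mem_sep.1 hx).2) (hcl₁ _ (closedUnder_closure F₁ _)).2.1 ?_
  ext x
  rw [ZFSet.mem_inter, ZFSet.mem_sep]
  constructor
  · rintro ⟨⟨-, hx⟩, hx1⟩
    exact hδ x hx1 (h12 hx)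
  · intro hx
    have hx1 : x ∈ om1 := isOrdinal_om1.mem_trans hx (Ordinal.toZFSet_mem_toZFSet_iff.2 δ.2)
    exact ⟨⟨om1_subset_H hμ h0 hx1, .base hx⟩, hx1⟩

/-! ### The forcing `P0 K μ` and the sets `H μ` -/

theorem sUnion_K_mem_H {K : ZFSet.{u}} {μ : Cardinal.{u}} (hμ : μ.IsRegular)
    (hlam : MuchLess (ZFSet.sUnion K) μ) : ZFSet.sUnion K ∈ H μ :=
  mem_H_of_mem hμ (mem_H_of_mem hμ hlam (ZFSet.mem_powerset.2 (fun _ h => h)))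
    (ZFSet.mem_powerset.2 (fun _ h => h))

theorem K_mem_H {K : ZFSet.{u}} {μ : Cardinal.{u}} (hμ : μ.IsRegular)
    (hlam : MuchLess (ZFSet.sUnion K) μ) : K ∈ H μ :=
  mem_H_of_mem hμ hlam (ZFSet.mem_powerset.2 fun _ hκ => ZFSet.mem_powerset.2 fun _ hν =>
    ZFSet.mem_sUnion_of_mem hν hκ)

section

variable {K : ZFSet.{u}} {μ : Cardinal.{u}}

theorem IsRun.codeRun_mem_H (hμ : μ.IsRegular) (hlam : MuchLess (ZFSet.sUnion K) μ)
    {M : ZFSet.{u}} {r : List Round.{u}} (hr : IsRun K M r) : codeRun r ∈ H μ := by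
  refine mem_H_of_finite hμ (fun z hz => ?_) (finite_codeRun r)
  obtain ⟨i, rfl⟩ := ZFSet.mem_range.1 hz
  obtain ⟨h1, h2, h3⟩ := hr.mem_K _ (List.get_mem r i)
  have hκ := mem_H_of_mem hμ (K_mem_H hμ hlam) h1
  exact pair_mem_H hμ (nat_mem_H hμ _) (pair_mem_H hμ (pair_mem_H hμ hκ (mem_H_of_mem hμ hκ h2))
    (mem_H_of_mem hμ hκ h3))

theorem IsStrategy.subset_H (hμ : μ.IsRegular) (hlam : MuchLess (ZFSet.sUnion K) μ)
    {M s : ZFSet.{u}} (hs : IsStrategy K M s) : s ⊆ H μ := by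
  intro z hz
  obtain ⟨x, y, rfl⟩ := hs.1.1 z hz
  obtain ⟨r, κ, ν, hr, hl, rfl⟩ := (hs.2.1 x).1 ⟨y, hz⟩
  have hκ := mem_H_of_mem hμ (K_mem_H hμ hlam) hl.1
  exact pair_mem_H hμ (pair_mem_H hμ (hr.codeRun_mem_H hμ hlam)
    (pair_mem_H hμ hκ (mem_H_of_mem hμ hκ hl.2.2))) (mem_H_of_mem hμ hκ (hs.2.2 r κ ν y hz))

/-- An element of a strategy is coded by finitely many members of `K ∪ ⋃ K`, a set of size less than
`μ`. Hence strategies, and with them the triples in conditions, belong to `H μ`. -/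
theorem IsStrategy.card_lt (hμ : μ.IsRegular) (hlam : MuchLess (ZFSet.sUnion K) μ)
    (h0 : Cardinal.aleph0 < μ) {M s : ZFSet.{u}} (hs : IsStrategy K M s) : s.card < μ := by
  let T : ZFSet.{u} := K ∪ ZFSet.sUnion K
  have hT : T.card < μ := ZFSet.card_union_le.trans_lt (Cardinal.add_lt_of_lt hμ.aleph0_le
    (card_lt_of_mem_H hμ (K_mem_H hμ hlam)) (card_lt_of_mem_H hμ (sUnion_K_mem_H hμ hlam)))
  have hTK : ∀ κ ∈ K, κ ∈ T := fun κ h => ZFSet.mem_union.2 (Or.inl h)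
  have hTU : ∀ κ ∈ K, ∀ ν ∈ κ, ν ∈ T := fun κ h ν h' =>
    ZFSet.mem_union.2 (Or.inr (ZFSet.mem_sUnion_of_mem h' h))
  let f : List (T × T × T) × (T × T × T) → ZFSet.{u} := fun p =>
    ZFSet.pair (position (p.1.map fun m => ⟨m.1.1, m.2.1.1, m.2.2.1⟩) p.2.1.1 p.2.2.1.1)
      p.2.2.2.1
  have hlist : ∀ r : List Round.{u}, (∀ m ∈ r, m.κ ∈ K ∧ m.ν ∈ m.κ ∧ m.ξ ∈ m.κ) →
      ∃ l : List (T × T × T), l.map (fun m => (⟨m.1.1, m.2.1.1, m.2.2.1⟩ : Round.{u})) = r := by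
    intro r
    induction r with
    | nil => exact fun _ => ⟨[], rfl⟩
    | cons m r ih =>
      intro h
      obtain ⟨l, hl⟩ := ih fun m' hm' => h m' (List.mem_cons_of_mem _ hm')
      obtain ⟨h1, h2, h3⟩ := h m (by simp)
      exact ⟨(⟨m.κ, hTK _ h1⟩, ⟨m.ν, hTU _ h1 _ h2⟩, ⟨m.ξ, hTU _ h1 _ h3⟩) :: l, by
        rw [List.map_cons, hl]⟩
  have hsub : (s : Set ZFSet.{u}) ⊆ Set.range f := by
    intro z hz
    obtain ⟨x, y, rfl⟩ := hs.1.1 z hz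
    obtain ⟨r, κ, ν, hr, hl, rfl⟩ := (hs.2.1 x).1 ⟨y, hz⟩
    obtain ⟨l, hl'⟩ := hlist r hr.mem_K
    exact ⟨(l, ⟨κ, hTK _ hl.1⟩, ⟨ν, hTU _ hl.1 _ hl.2.2⟩,
      ⟨y, hTU _ hl.1 _ (hs.2.2 r κ ν y hz)⟩), by simp only [f, hl']⟩
  have h1 := (Cardinal.mk_le_mk_of_subset hsub).trans Cardinal.mk_range_le
  change Cardinal.mk s ≤ _ at h1
  have hμ0 : Cardinal.aleph0 < Cardinal.lift.{u + 1} μ := Cardinal.aleph0_lt_lift.2 h0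
  have hT' : Cardinal.mk T < Cardinal.lift.{u + 1} μ := by
    rw [ZFSet.cardinalMk_coe_sort]
    exact Cardinal.lift_lt.2 hT
  have hP : Cardinal.mk (T × T × T) < Cardinal.lift.{u + 1} μ := by
    rw [Cardinal.mk_prod, Cardinal.mk_prod]
    simp only [Cardinal.lift_id]
    exact Cardinal.mul_lt_of_lt hμ0.le hT' (Cardinal.mul_lt_of_lt hμ0.le hT' hT')
  have hL : Cardinal.mk (List (T × T × T)) < Cardinal.lift.{u + 1} μ :=
    (Cardinal.mk_list_le_max _).trans_lt (max_lt hμ0 hP)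
  rw [← Cardinal.lift_lt.{u, u + 1}, ← ZFSet.cardinalMk_coe_sort]
  refine h1.trans_lt ?_
  rw [Cardinal.mk_prod]
  simp only [Cardinal.lift_id]
  exact Cardinal.mul_lt_of_lt hμ0.le hL hP

theorem triple_mem_H (hμ : μ.IsRegular) (hlam : MuchLess (ZFSet.sUnion K) μ)
    (h0 : Cardinal.aleph0 < μ) {M s : ZFSet.{u}} {r : List Round.{u}} (hM : M ∈ W0 K μ)
    (hs : IsStrategy K M s) (hr : IsRun K M r) : triple M r s ∈ H μ :=
  pair_mem_H hμ (mem_H_of_countable hμ h0 hM.2.1.subset hM.1)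
    (pair_mem_H hμ (hr.codeRun_mem_H hμ hlam)
      (mem_H_of_subset hμ (hs.subset_H hμ hlam) (hs.card_lt hμ hlam h0)))

theorem IsCond.of_mem {p M s : ZFSet.{u}} {r : List Round.{u}} (hp : IsCond K μ p)
    (h : triple M r s ∈ p) : M ∈ W0 K μ ∧ IsWinningStrategy K M s ∧ IsRun K M r ∧
      Follows s r := by
  obtain ⟨M', r', s', h1, h2⟩ := hp.elem _ h
  obtain ⟨rfl, rfl, rfl⟩ := triple_inj.1 h1
  exact h2

theorem IsCond.subset {p q : ZFSet.{u}} (hq : IsCond K μ q) (hpq : p ⊆ q) : IsCond K μ p where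
  finite := hq.finite.subset hpq
  elem t ht := hq.elem t (hpq ht)
  eq _ _ _ _ _ _ h1 h2 := hq.eq _ _ _ _ _ _ (hpq h1) (hpq h2)
  mem _ _ _ _ _ _ h1 h2 := hq.mem _ _ _ _ _ _ (hpq h1) (hpq h2)

theorem isCond_singleton {M s : ZFSet.{u}} (hM : M ∈ W0 K μ) (hs : IsWinningStrategy K M s) :
    IsCond K μ {triple M [] s} where
  finite := by
    rw [ZFSet.coe_singleton]
    exact Set.finite_singleton _
  elem t ht := ⟨M, [], s, ZFSet.mem_singleton.1 ht, hM, hs, trivial, fun r₁ m r₂ h => by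
    simp at h⟩
  eq _ _ _ _ _ _ h1 h2 _ := (ZFSet.mem_singleton.1 h1).trans (ZFSet.mem_singleton.1 h2).symm
  mem _ _ _ _ _ _ h1 h2 h3 := by
    obtain ⟨rfl, -, -⟩ := triple_inj.1 (ZFSet.mem_singleton.1 h1)
    obtain ⟨rfl, -, -⟩ := triple_inj.1 (ZFSet.mem_singleton.1 h2)
    exact absurd h3 (ZFSet.mem_irrefl _)

theorem P0_LE_iff {p q : ZFSet.{u}} : (P0 K μ).LE q p ↔
    q ∈ (P0 K μ).carrier ∧ p ∈ (P0 K μ).carrier ∧ CondLE q p := by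
  constructor
  · intro h
    obtain ⟨a, ha, b, hb, h1, h2⟩ := ZFSet.mem_pairSep.1 h
    obtain ⟨rfl, rfl⟩ := ZFSet.pair_inj.1 h1
    exact ⟨ha, hb, h2⟩
  · rintro ⟨hq, hp, h⟩
    exact ZFSet.mem_pairSep.2 ⟨q, hq, p, hp, rfl, h⟩

theorem mem_P0 (hμ : μ.IsRegular) (hlam : MuchLess (ZFSet.sUnion K) μ) {p : ZFSet.{u}} :
    p ∈ (P0 K μ).carrier ↔ IsCond K μ p :=
  mem_conditions hμ hlam

theorem carrier_mem_H {P : Forcing.{u}} {θ : Cardinal.{u}} (hθ : θ.IsRegular)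
    (h : MuchLess P.carrier θ) : P.carrier ∈ H θ :=
  mem_H_of_mem hθ (mem_H_of_mem hθ h (ZFSet.mem_powerset.2 (fun _ h => h)))
    (ZFSet.mem_powerset.2 (fun _ h => h))

theorem toSet_mem_H {P : Forcing.{u}} {θ : Cardinal.{u}} (hθ : θ.IsRegular)
    (h : MuchLess P.carrier θ) : P.toSet ∈ H θ :=
  have hc := carrier_mem_H hθ h
  pair_mem_H hθ hc (mem_H_of_subset_mem hθ (prod_mem_H hθ hc hc) P.le_sub)

/-- Every model from `W0 K μ` belongs to `H θ` for `θ ≫ P0 K μ`. -/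
theorem W0_subset_H {θ : Cardinal.{u}} (hμ : μ.IsRegular) (hlam : MuchLess (ZFSet.sUnion K) μ)
    (hθ : θ.IsRegular) (h : MuchLess (P0 K μ).carrier θ) {M : ZFSet.{u}} (hM : M ∈ W0 K μ) :
    M ∈ ZFSet.sUnion (ZFSet.sUnion (ZFSet.sUnion (P0 K μ).carrier)) ∧
      ZFSet.sUnion (ZFSet.sUnion (ZFSet.sUnion (P0 K μ).carrier)) ∈ H θ := by
  refine ⟨?_, sUnion_mem_H hθ (sUnion_mem_H hθ (sUnion_mem_H hθ (carrier_mem_H hθ h)))⟩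
  obtain ⟨s, hs⟩ := hM.2.2.2
  refine ZFSet.mem_sUnion_of_mem (z := {M}) (by simp) ?_
  refine ZFSet.mem_sUnion_of_mem (z := triple M [] s) (by simp [triple, ZFSet.pair]) ?_
  exact ZFSet.mem_sUnion_of_mem (z := {triple M [] s}) (by simp)
    ((mem_P0 hμ hlam).2 (isCond_singleton hM hs))

theorem aleph0_lt_of_W0 {θ : Cardinal.{u}} (hμ : μ.IsRegular)
    (hlam : MuchLess (ZFSet.sUnion K) μ) (hθ : θ.IsRegular) (h : MuchLess (P0 K μ).carrier θ)
    {M : ZFSet.{u}} (hM : M ∈ W0 K μ) : Cardinal.aleph0 < θ := by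
  obtain ⟨h1, h2⟩ := W0_subset_H hμ hlam hθ h hM
  refine lt_of_le_of_lt ?_ (card_lt_of_mem_H hθ (mem_H_of_mem hθ h2 h1))
  by_contra hlt
  exact hM.2.1.infinite hμ hM.2.2.1 (finite_iff_card_lt.2 (not_le.1 hlt))

/-- Each `x ∈ H μ` lies in some model from `W0 K μ`, by `exists_winning_model` for the operation
with constant value `{x}`. These models all occur in conditions, so `H μ` is included in an iterated
union of the carrier. -/
theorem H_mem_H {θ : Cardinal.{u}} (hK : ∀ κ ∈ K, IsUncountableRegular κ) (hω₁ : om1 ∉ K)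
    (hμ : μ.IsRegular) (hlam : MuchLess (ZFSet.sUnion K) μ) (h0 : Cardinal.aleph0 < μ)
    (hθ : θ.IsRegular) (h : MuchLess (P0 K μ).carrier θ) : H μ ∈ H θ := by
  have : Nonempty (Set.Iio (Ordinal.omega.{u} 1)) := ⟨⟨0, Ordinal.omega_pos 1⟩⟩
  have key : ∀ x ∈ H μ, ∃ M ∈ W0 K μ, x ∈ M := by
    intro x hx
    obtain ⟨A, hAc, hA, -, hAe, hAK, hs⟩ := exists_winning_model hK hω₁ hμ hlam h0
      (F := fun _ => {x}) (fun _ => Set.countable_singleton x) IsStationary.univ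
    exact ⟨ZFSet.sep (· ∈ A) (H μ), ⟨hAc.mono fun x hx => (ZFSet.mem_sep.1 hx).2, hAe,
      ZFSet.mem_sep.2 ⟨K_mem_H hμ hlam, hAK⟩, hs⟩, ZFSet.mem_sep.2 ⟨hx, hA [] (by simp) rfl⟩⟩
  obtain ⟨M, hM, -⟩ := key ∅ (empty_mem_H hμ)
  refine mem_H_of_subset_mem hθ (sUnion_mem_H hθ (W0_subset_H hμ hlam hθ h hM).2) fun x hx => ?_
  obtain ⟨M, hM, hxM⟩ := key x hx
  exact ZFSet.mem_sUnion_of_mem hxM (W0_subset_H hμ hlam hθ h hM).1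

end

/-! ### Strong semiproperness -/

section

variable {K : ZFSet.{u}} {μ θ : Cardinal.{u}}

/-- Every condition is semigeneric, each `q` being its own trace: `Hull M q = M`. -/
theorem Forcing.stronglySemiproper_of_subset {P : Forcing.{u}} (hθ : θ.IsRegular) {M : ZFSet.{u}}
    (hM : Elementary M (H θ)) (hP : P.toSet ∈ M) (hsub : P.carrier ⊆ M) :
    P.StronglySemiproper M := by
  intro p hp _
  refine ⟨p, hp, P.refl p hp, fun q hq _ => ⟨q, hq, ?_, fun r _ hr hrq => ⟨r, hr, P.refl r hr, hrq⟩⟩⟩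
  have h1 : Hull M q = M := ZFSet.ext fun x => ⟨fun h => hM.Hull_subset hθ (hsub hq) h,
    fun h => hM.subset_Hull hθ (hM.fst_mem hθ hP) hq h⟩
  rw [ParallelOm1, h1]

theorem trace_mem_of_triple_mem (hμ : μ.IsRegular) (h0 : Cardinal.aleph0 < μ)
    {N M s : ZFSet.{u}} {r : List Round.{u}} (hN : Elementary N (H μ))
    (hNc : (N : Set ZFSet.{u}).Countable) (hM : M ∈ W0 K μ) (h : triple M r s ∈ N) :
    M ∩ om1 ∈ N ∩ om1 :=
  hM.2.1.trace_mem_trace hN hμ h0 hM.1 hNc (hN.fst_mem hμ h)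

theorem stronglySemiproper_P0 (hμ : μ.IsRegular) (hlam : MuchLess (ZFSet.sUnion K) μ)
    (h0 : Cardinal.aleph0 < μ) (hθ : θ.IsRegular) (hθ0 : Cardinal.aleph0 < θ)
    {M : ZFSet.{u}} (hM : Elementary M (H θ))
    (hP : (P0 K μ).toSet ∈ M) (hH : H μ ∈ M) (hM₀ : M ∩ H μ ∈ W0 K μ) :
    (P0 K μ).StronglySemiproper M := by
  have hcond := @mem_P0 K μ hμ hlam
  have hcarM : (P0 K μ).carrier ∈ M := hM.fst_mem hθ hP
  obtain ⟨hM₀c, hM₀e, hKM₀, s₀, hs₀⟩ := id hM₀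
  have hKH : ∀ κ ∈ K, κ ∈ H μ := fun κ hκ => mem_H_of_mem hμ (K_mem_H hμ hlam) hκ
  have htriple : ∀ {p M r s}, IsCond K μ p → triple M r s ∈ p → triple M r s ∈ H μ :=
    fun hp h => triple_mem_H hμ hlam h0 (hp.of_mem h).1 (hp.of_mem h).2.1.1 (hp.of_mem h).2.2.1
  have htr₀ : (M ∩ H μ) ∩ om1 = M ∩ om1 := by
    ext x
    simp only [ZFSet.mem_inter]
    exact ⟨fun h => ⟨h.1.1, h.2⟩, fun h => ⟨⟨h.1, om1_subset_H hμ h0 h.2⟩, h.2⟩⟩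
  -- Conditions are finite, so an elementary submodel that contains one also includes it.
  have hfin : ∀ {p N : ZFSet.{u}}, IsCond K μ p → Elementary N (H θ) → p ∈ N →
      ∀ x ∈ p, x ∈ N ∩ H μ := by
    intro p N hp hN hpN x hx
    refine ZFSet.mem_inter.2 ⟨hN.subset_of_countable hθ hθ0 hpN hp.finite.countable hx, ?_⟩
    obtain ⟨M₁, r₁, s₁, rfl, -⟩ := hp.elem x hx
    exact htriple hp hx
  intro p hp hpM
  have hpc := hcond.1 hp
  have hpM₀ := hfin hpc hM hpM
  have htrp : ∀ M₁ r₁ s₁, triple M₁ r₁ s₁ ∈ p → M₁ ∩ om1 ∈ (M ∩ H μ) ∩ om1 := fun M₁ r₁ s₁ h =>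
    trace_mem_of_triple_mem hμ h0 hM₀e hM₀c (hpc.of_mem h).1 (hpM₀ _ h)
  -- The new triple goes on top: all elements of `p` lie in `M ∩ H μ` and have smaller traces.
  have hpstar : IsCond K μ (insert (triple (M ∩ H μ) [] s₀) p) := by
    refine ⟨?_, fun t ht => ?_, fun M₁ r₁ s₁ M₂ r₂ s₂ h1 h2 h12 => ?_,
      fun M₁ r₁ s₁ M₂ r₂ s₂ h1 h2 h12 => ?_⟩
    · rw [ZFSet.coe_insert]
      exact hpc.finite.insert _
    · rcases ZFSet.mem_insert_iff.1 ht with rfl | ht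
      · exact ⟨_, [], s₀, rfl, hM₀, hs₀, trivial, fun r₁ m r₂ h => by simp at h⟩
      · exact hpc.elem t ht
    · rcases ZFSet.mem_insert_iff.1 h1 with h1' | h1' <;>
        rcases ZFSet.mem_insert_iff.1 h2 with h2' | h2'
      · exact h1'.trans h2'.symm
      · obtain ⟨rfl, -, -⟩ := triple_inj.1 h1'
        exact absurd (h12 ▸ htrp _ _ _ h2') (ZFSet.mem_irrefl _)
      · obtain ⟨rfl, -, -⟩ := triple_inj.1 h2'
        exact absurd (h12 ▸ htrp _ _ _ h1') (ZFSet.mem_irrefl _)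
      · exact hpc.eq _ _ _ _ _ _ h1' h2' h12
    · rcases ZFSet.mem_insert_iff.1 h1 with h1' | h1' <;>
        rcases ZFSet.mem_insert_iff.1 h2 with h2' | h2'
      · obtain ⟨rfl, -, -⟩ := triple_inj.1 h1'
        obtain ⟨rfl, -, -⟩ := triple_inj.1 h2'
        exact absurd h12 (ZFSet.mem_irrefl _)
      · obtain ⟨rfl, -, -⟩ := triple_inj.1 h1'
        exact absurd h12 (ZFSet.mem_asymm (htrp _ _ _ h2'))
      · obtain ⟨rfl, rfl, -⟩ := triple_inj.1 h2'
        exact hpM₀ _ h1'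
      · exact hpc.mem _ _ _ _ _ _ h1' h2' h12
  refine ⟨_, hcond.2 hpstar, P0_LE_iff.2 ⟨hcond.2 hpstar, hp, fun M₁ r₁ s₁ h =>
    ⟨r₁, ZFSet.mem_insert_of_mem _ h, List.prefix_rfl⟩⟩, fun q hq hqle => ?_⟩
  have hqc := hcond.1 hq
  obtain ⟨r, hrq, -⟩ := (P0_LE_iff.1 hqle).2.2 _ _ _ (ZFSet.mem_insert _ _)
  obtain ⟨-, -, hrun, -⟩ := hqc.of_mem hrq
  have hNe : Elementary (model (M ∩ H μ) r) (H μ) := hrun.elementary hμ hM₀e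
  have hNc := countable_model r hM₀c
  have hNtr : model (M ∩ H μ) r ∩ om1 = (M ∩ H μ) ∩ om1 := hrun.trace_model
  have hKN : K ∈ model (M ∩ H μ) r := hrun.subset_model hμ hM₀e hKM₀
  obtain ⟨hMr, hMsub, hinter⟩ := hrun.model_inter hθ hμ hKH hM hH
  generalize hN : model (M ∩ H μ) r = N at *
  generalize model M r = M' at *
  -- The trace of `q` is `q ∩ N`; as a finite subset of `N` it is an element of `N`.
  have htc : IsCond K μ (ZFSet.sep (· ∈ N) q) := hqc.subset ZFSet.sep_subset
  have htN : ZFSet.sep (· ∈ N) q ∈ N := hNe.mem_of_finite_subset hμ hKN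
    (fun x hx => (ZFSet.mem_sep.1 hx).2) htc.finite
  have htM' : ZFSet.sep (· ∈ N) q ∈ M' := by
    have h : ZFSet.sep (· ∈ N) q ∈ M' ∩ H μ := by
      rw [hinter]
      exact htN
    exact (ZFSet.mem_inter.1 h).1
  -- `M'` is the result of playing `r` on `M`. It has the same countable ordinals as `M`, so this
  -- inclusion bounds those of the hull.
  have hHull : Hull M (ZFSet.sep (· ∈ N) q) ⊆ M' := fun x hx =>
    hMr.Hull_subset hθ htM' (Hull_mono hMsub _ hx)
  refine ⟨ZFSet.sep (· ∈ N) q, hcond.2 htc, ?_, fun w hw hwP hwle => ?_⟩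
  · ext x
    simp only [ZFSet.mem_inter]
    refine ⟨fun hx => ⟨?_, hx.2⟩,
      fun hx => ⟨hM.subset_Hull hθ hcarM (hcond.2 htc) hx.1, hx.2⟩⟩
    have h1 : x ∈ N ∩ om1 := by
      rw [← hinter]
      exact ZFSet.mem_inter.2 ⟨ZFSet.mem_inter.2 ⟨hHull hx.1, om1_subset_H hμ h0 hx.2⟩, hx.2⟩
    rw [hNtr, htr₀] at h1
    exact (ZFSet.mem_inter.1 h1).1
  have hwc := hcond.1 hwP
  have hwN : ∀ x ∈ w, x ∈ N := by
    rw [← hinter]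
    exact hfin hwc hMr (hHull hw)
  have hwtr : ∀ {M₁ r₁ s₁}, triple M₁ r₁ s₁ ∈ w → M₁ ∩ om1 ∈ (M ∩ H μ) ∩ om1 := by
    intro M₁ r₁ s₁ h
    rw [← hNtr]
    exact trace_mem_of_triple_mem hμ h0 hNe hNc (hwc.of_mem h).1 (hwN _ h)
  have hord : ∀ {M₁}, M₁ ∈ W0 K μ → (M₁ ∩ om1).IsOrdinal := fun h =>
    isOrdinal_om1.mem (h.2.1.trace_mem_om1 hμ h0 h.1)
  -- Compare traces with `M ∩ H μ`: a smaller one would put the triple into `N`, an equal one makes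
  -- it the triple of `M ∩ H μ` itself, and in the case of a larger one the last model contains the
  -- triple of `M ∩ H μ` and hence includes `N`.
  have habove : ∀ {M₂ r₂ s₂}, triple M₂ r₂ s₂ ∈ q → triple M₂ r₂ s₂ ∉ N →
      N ⊆ model M₂ r₂ ∧ (M ∩ H μ) ∩ om1 ⊆ M₂ ∩ om1 := by
    intro M₂ r₂ s₂ h2 h2N
    obtain ⟨hM₂, -, hr₂, -⟩ := hqc.of_mem h2
    rcases (hord hM₂).mem_trichotomous (hord hM₀) with h | h | h
    · exact absurd (hN ▸ hqc.mem _ _ _ _ _ _ h2 hrq h) h2N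
    · obtain ⟨rfl, rfl, -⟩ := triple_inj.1 (hqc.eq _ _ _ _ _ _ h2 hrq h)
      exact ⟨hN ▸ fun _ h => h, fun _ h => h⟩
    · refine ⟨?_, (hord hM₂).subset_of_mem h⟩
      have h1 := model_subset_of_triple_mem hμ h0 (hr₂.elementary hμ hM₂.2.1) hM₀c
        (hqc.mem _ _ _ _ _ _ hrq h2 h)
      rwa [hN] at h1
  have hmem : ∀ {x}, x ∈ w ∪ ZFSet.sep (· ∉ N) q ↔ x ∈ w ∨ x ∈ q ∧ x ∉ N := by
    intro x
    rw [ZFSet.mem_union, ZFSet.mem_sep]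
  -- All of `w` lies in `N`, hence in every last model of `q \ N`; the traces in `w` are below those
  -- in `q \ N`, so no other mixed case arises.
  have hq' : IsCond K μ (w ∪ ZFSet.sep (· ∉ N) q) := by
    refine ⟨?_, fun t ht => ?_, fun M₁ r₁ s₁ M₂ r₂ s₂ h1 h2 h12 => ?_,
      fun M₁ r₁ s₁ M₂ r₂ s₂ h1 h2 h12 => ?_⟩
    · rw [ZFSet.coe_union]
      exact hwc.finite.union (hqc.finite.subset ZFSet.sep_subset)
    · exact (hmem.1 ht).elim (hwc.elem t) fun h => hqc.elem t h.1
    · rcases hmem.1 h1 with h1' | h1' <;> rcases hmem.1 h2 with h2' | h2'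
      · exact hwc.eq _ _ _ _ _ _ h1' h2' h12
      · exact absurd (h12 ▸ (habove h2'.1 h2'.2).2 (hwtr h1')) (ZFSet.mem_irrefl _)
      · exact absurd (h12 ▸ (habove h1'.1 h1'.2).2 (hwtr h2')) (ZFSet.mem_irrefl _)
      · exact hqc.eq _ _ _ _ _ _ h1'.1 h2'.1 h12
    · rcases hmem.1 h1 with h1' | h1' <;> rcases hmem.1 h2 with h2' | h2'
      · exact hwc.mem _ _ _ _ _ _ h1' h2' h12
      · exact (habove h2'.1 h2'.2).1 (hwN _ h1')
      · exact absurd h12 (ZFSet.mem_asymm ((habove h1'.1 h1'.2).2 (hwtr h2')))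
      · exact hqc.mem _ _ _ _ _ _ h1'.1 h2'.1 h12
  have hq'P := hcond.2 hq'
  refine ⟨_, hq'P, P0_LE_iff.2 ⟨hq'P, hwP, fun M₁ r₁ s₁ h =>
    ⟨r₁, hmem.2 (Or.inl h), List.prefix_rfl⟩⟩, P0_LE_iff.2 ⟨hq'P, hq, fun M₁ r₁ s₁ h => ?_⟩⟩
  by_cases hxN : triple M₁ r₁ s₁ ∈ N
  · obtain ⟨r', hr', hpre⟩ := (P0_LE_iff.1 hwle).2.2 _ _ _ (ZFSet.mem_sep.2 ⟨h, hxN⟩)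
    exact ⟨r', hmem.2 (Or.inl hr'), hpre⟩
  · exact ⟨r₁, hmem.2 (Or.inr ⟨h, hxN⟩), List.prefix_rfl⟩

end

/-! ### Projective stationarity -/

theorem omegaSet_mem_ctblSubsets {θ : Cardinal.{u}} (hθ : θ.IsRegular) :
    omegaSet ∈ ctblSubsets (H θ) := by
  have h1 : (omegaSet : Set ZFSet.{u}) =
      Set.range fun n : ℕ => Ordinal.toZFSet (n : Ordinal.{u}) := by
    ext x
    exact mem_omegaSet
  refine ⟨fun x hx => ?_, ?_, ?_⟩
  · obtain ⟨n, rfl⟩ := mem_omegaSet.1 hx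
    exact nat_mem_H hθ n
  · rw [h1]
    exact Set.countable_range _
  · rw [h1]
    exact Set.infinite_range_of_injective fun m n h => by
      exact_mod_cast Ordinal.toZFSet_injective h

/-- A club in `[H θ]^ω` is replaced by the operation `F` of `IsClubIn.exists_operation`, so that it
can be combined with Skolem functions in a single closure. -/
theorem isProjectiveStationary_of_operations {θ : Cardinal.{u}} (hθ : θ.IsRegular)
    (h0 : Cardinal.aleph0 < θ) {Q : ZFSet.{u} → Prop}
    (hQ : ∀ F : List ZFSet.{u} → Set ZFSet.{u}, (∀ l, (F l).Countable) →
      ∀ S : Set (Set.Iio (Ordinal.omega.{u} 1)), IsStationary S →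
        ∃ A : Set ZFSet.{u}, A.Countable ∧ ClosedUnder F A ∧
          (∃ δ ∈ S, ∀ x ∈ om1, x ∈ A ↔ x ∈ δ.1.toZFSet) ∧ Q (ZFSet.sep (· ∈ A) (H θ))) :
    IsProjectiveStationary (H θ) {M | M ∈ ctblSubsets (H θ) ∧ Q M} := by
  refine ⟨fun M hM => hM.1, fun S hS => ⟨fun M hM => hM.1.1, fun C hC => ?_⟩⟩
  obtain ⟨c₀, hc₀, -⟩ := hC.unbounded _ (omegaSet_mem_ctblSubsets hθ)
  obtain ⟨F, hF, hFC⟩ := hC.exists_operation hc₀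
  obtain ⟨A, hAc, hA, ⟨δ, hδS, hδ⟩, hAQ⟩ := hQ F hF S hS
  have hC' := hFC A hA hAc
  refine ⟨_, ⟨⟨hC.subset hC', hAQ⟩, δ, hδS, ?_⟩, hC'⟩
  ext x
  rw [ZFSet.mem_inter, ZFSet.mem_sep]
  refine ⟨fun hx => (hδ x hx.2).1 hx.1.2, fun hx => ?_⟩
  have hx1 : x ∈ om1 := isOrdinal_om1.mem_trans hx (Ordinal.toZFSet_mem_toZFSet_iff.2 δ.2)
  exact ⟨⟨om1_subset_H hθ h0 hx1, (hδ x hx1).2 hx⟩, hx1⟩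

/-! ### The case `μ = ω` -/

theorem eq_H_of_elementary_aleph0 {M a : ZFSet.{u}} (hM : Elementary M (H Cardinal.aleph0))
    (ha : a ∈ M) : M = H Cardinal.aleph0 := by
  have hreg := Cardinal.isRegular_aleph0.{u}
  have key : ∀ x : ZFSet.{u}, x ∈ H Cardinal.aleph0 → x ∈ M := by
    intro x
    refine ZFSet.inductionOn x fun x ih hx => ?_
    exact hM.mem_of_finite_subset hreg ha (fun y hy => ih y hy (mem_H_of_mem hreg hx hy))
      (finite_iff_card_lt.2 (card_lt_of_mem_H hreg hx))
  exact ZFSet.ext fun x => ⟨fun h => hM.subset h, key x⟩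

theorem elementary_refl (X : ZFSet.{u}) : Elementary X X :=
  ⟨Language.ElementaryEmbedding.refl _ _, fun _ => rfl⟩

theorem countable_H_aleph0 : (H Cardinal.aleph0.{u} : Set ZFSet.{u}).Countable := by
  rw [countable_iff_card_le]
  refine (ZFSet.card_mono ZFSet.sep_subset).trans ?_
  rw [ZFSet.card_vonNeumann, Cardinal.ord_aleph0, Cardinal.preBeth_omega]

/-- With `K = ∅` the first player has no legal move. -/
theorem H_aleph0_mem_W0 (hlam : MuchLess (ZFSet.sUnion ∅) Cardinal.aleph0.{u}) :
    H Cardinal.aleph0 ∈ W0 (∅ : ZFSet.{u}) Cardinal.aleph0 := by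
  have hreg := Cardinal.isRegular_aleph0.{u}
  refine ⟨countable_H_aleph0, elementary_refl _, empty_mem_H hreg,
    exists_isWinningStrategy hreg hlam ?_⟩
  rintro ⟨T, hT⟩
  cases T with
  | leaf => exact hT
  | node κ ν next => exact ZFSet.notMem_empty _ hT.1.1

/-- The only model is the set of hereditarily finite sets, the only run and the only strategy are
empty. The forcing is therefore finite and contained in every model that matters. -/
theorem carrier_P0_subset (hlam : MuchLess (ZFSet.sUnion ∅) Cardinal.aleph0.{u}) :
    (P0 ∅ Cardinal.aleph0.{u}).carrier ⊆
      ZFSet.powerset {triple (H Cardinal.aleph0) [] (∅ : ZFSet.{u})} := by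
  intro p hp
  have hpc := (mem_P0 Cardinal.isRegular_aleph0 hlam).1 hp
  rw [ZFSet.mem_powerset]
  intro t ht
  obtain ⟨M, r, s, rfl, hM, hs, hr, -⟩ := hpc.elem t ht
  have h1 := eq_H_of_elementary_aleph0 hM.2.1 hM.2.2.1
  have h2 : r = [] := by
    cases r with
    | nil => rfl
    | cons m r => exact absurd hr.1.1 (ZFSet.notMem_empty _)
  have h3 : s = ∅ := by
    rw [ZFSet.eq_empty]
    intro z hz
    obtain ⟨x, y, rfl⟩ := hs.1.1.1 z hz
    obtain ⟨r, κ, ν, -, hl, -⟩ := (hs.1.2.1 x).1 ⟨y, hz⟩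
    exact ZFSet.notMem_empty _ hl.1
  rw [ZFSet.mem_singleton, h1, h2, h3]

theorem stronglySSP_P0_aleph0 (hlam : MuchLess (ZFSet.sUnion ∅) Cardinal.aleph0.{u}) :
    (P0 ∅ Cardinal.aleph0.{u}).StronglySSP := by
  have hreg := Cardinal.isRegular_aleph0.{u}
  intro θ hθ hPθ
  have h0 := aleph0_lt_of_W0 hreg hlam hθ hPθ (H_aleph0_mem_W0 hlam)
  refine isProjectiveStationary_of_operations hθ h0 fun F hF S hS => ?_
  let P := P0 ∅ Cardinal.aleph0.{u}
  let G : List ZFSet.{u} → Set ZFSet.{u} := fun l => F l ∪ (skolem (H θ) l ∪ {P.toSet})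
  have hG : ∀ l, (G l).Countable := fun l => (hF l).union ((skolem_countable _ l).union
    (Set.countable_singleton _))
  obtain ⟨δ, hδS, hδ⟩ := hS (isClub_closureOrd hG)
  have hA : ClosedUnder G (closureOrd G δ.1) := closedUnder_closure _ _
  have hMe : Elementary (ZFSet.sep (· ∈ closureOrd G δ.1) (H θ)) (H θ) :=
    elementary_of_skolem fun l hl x hx => hA l hl (Or.inr (Or.inl hx))
  have hPM : P.toSet ∈ ZFSet.sep (· ∈ closureOrd G δ.1) (H θ) :=
    ZFSet.mem_sep.2 ⟨toSet_mem_H hθ hPθ, hA [] (by simp) (Or.inr (Or.inr rfl))⟩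
  refine ⟨closureOrd G δ.1, countable_closureOrd hG δ.2, fun l hl x hx => hA l hl (Or.inl hx),
    ⟨δ, hδS, fun x hx => mem_closureOrd_iff hδ hx⟩, hMe, hPM,
    Forcing.stronglySemiproper_of_subset hθ hMe hPM
      (hMe.subset_of_countable hθ h0 (hMe.fst_mem hθ hPM) ?_)⟩
  refine countable_iff_card_le.2 ((ZFSet.card_mono (carrier_P0_subset hlam)).trans ?_)
  rw [ZFSet.card_powerset, ZFSet.card_singleton, Cardinal.power_one]
  exact (Cardinal.natCast_lt_aleph0 (n := 2)).le

theorem stronglySSP_P0 {K : ZFSet.{u}} (hK : ∀ κ ∈ K, IsUncountableRegular κ)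
    (hω₁ : om1 ∉ K) {μ : Cardinal.{u}} (hμ : μ.IsRegular)
    (hlam : MuchLess (ZFSet.sUnion K) μ) (h0 : Cardinal.aleph0 < μ) :
    (P0 K μ).StronglySSP := by
  intro θ hθ hPθ
  have hHθ := H_mem_H hK hω₁ hμ hlam h0 hθ hPθ
  have h0θ : Cardinal.aleph0 < θ := by
    have h1 := card_lt_of_mem_H hθ (mem_H_of_mem hθ hHθ (omegaSet_mem_H hμ h0))
    rwa [omegaSet, Ordinal.card_toZFSet, Ordinal.card_omega0] at h1
  refine isProjectiveStationary_of_operations hθ h0θ fun F hF S hS => ?_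
  -- One set `A` serves both levels: `A ∩ H θ` is the model `M`, and `A ∩ H μ = M ∩ H μ` is the
  -- model on which the second player wins.
  obtain ⟨A, hAc, hA, htr, hAe, hAK, hs⟩ := exists_winning_model hK hω₁ hμ hlam h0
    (F := fun l => F l ∪ (skolem (H θ) l ∪ {(P0 K μ).toSet, H μ}))
    (fun l => (hF l).union ((skolem_countable _ l).union (Set.toFinite _).countable)) hS
  have hMe : Elementary (ZFSet.sep (· ∈ A) (H θ)) (H θ) :=
    elementary_of_skolem fun l hl x hx => hA l hl (Or.inr (Or.inl hx))
  have hPM : (P0 K μ).toSet ∈ ZFSet.sep (· ∈ A) (H θ) :=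
    ZFSet.mem_sep.2 ⟨toSet_mem_H hθ hPθ, hA [] (by simp) (Or.inr (Or.inr (Or.inl rfl)))⟩
  have hHM : H μ ∈ ZFSet.sep (· ∈ A) (H θ) :=
    ZFSet.mem_sep.2 ⟨hHθ, hA [] (by simp) (Or.inr (Or.inr (Or.inr rfl)))⟩
  have hM₀ : ZFSet.sep (· ∈ A) (H θ) ∩ H μ = ZFSet.sep (· ∈ A) (H μ) := by
    ext x
    simp only [ZFSet.mem_inter, ZFSet.mem_sep]
    exact ⟨fun h => ⟨h.2, h.1.2⟩, fun h => ⟨⟨mem_H_of_mem hθ hHθ h.1, h.2⟩, h.1⟩⟩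
  refine ⟨A, hAc, fun l hl x hx => hA l hl (Or.inl hx), htr, hMe, hPM,
    stronglySemiproper_P0 hμ hlam h0 hθ h0θ hMe hPM hHM ?_⟩
  rw [hM₀]
  exact ⟨hAc.mono fun x hx => (ZFSet.mem_sep.1 hx).2, hAe,
    ZFSet.mem_sep.2 ⟨K_mem_H hμ hlam, hAK⟩, hs⟩

end Namba

end

theorem mainTheorem5 (K : ZFSet.{u})
    (hK : ∀ κ ∈ K, Namba.IsUncountableRegular κ) (hω₁ : Namba.om1 ∉ K)
    (μ : Cardinal.{u}) (hμ : μ.IsRegular) (hlam : Namba.MuchLess (ZFSet.sUnion K) μ) :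
    (Namba.P0 K μ).StronglySSP := by
  rcases hμ.aleph0_le.eq_or_lt with rfl | h0
  -- Regularity permits `μ = ℵ₀`. The elements of `K` are uncountable and belong to `H μ`, so in
  -- this case there are none.
  · have hK0 : K = ∅ := by
      rw [ZFSet.eq_empty]
      intro κ hκ
      have h1 := Namba.card_lt_of_mem_H hμ
        (Namba.mem_H_of_mem hμ (Namba.K_mem_H hμ hlam) hκ)
      obtain ⟨c, hc, -, rfl⟩ := hK κ hκ
      rw [Ordinal.card_toZFSet, Cardinal.card_ord] at h1
      exact lt_asymm hc h1
    subst hK0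
    exact Namba.stronglySSP_P0_aleph0 hlam
  · exact Namba.stronglySSP_P0 hK hω₁ hμ hlam h0
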